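/- Let $\mathbb{D}=\mathbb{Z}\left[\frac16\right]$, let $F_2$ be the free group freely generated by $y_1,y_2$, let $$P=\{y_1,\ y_2,\ y_1y_2,\ y_1^{-1}y_2,\ y_1^{2}y_2,\ y_1y_2^{2},\ [y_1,y_2]\},\qquad [y_1,y_2]=y_1^{-1}y_2^{-1}y_1y_2,$$ and let $$\mathbf{A}=\frac{\mathbb{D}F_2}{\langle (x-1)^3 \mid x\in P\rangle}$$ be the quotient of the group ring $\mathbb{D}F_2$ by the two-sided ideal generated by the elements $(x-1)^3$, $x\in P$. Let $\mathbf{B}$ be the image in $\mathbf{A}$ of the augmentation ideal of $\mathbb{D}F_2$, and let $G$ be the image of $F_2$ in the group of units of $\mathbf{A}$. Then: (i) $\mathbf{A}$ is a free $\mathbb{D}$-module of rank $18$; (ii) $\mathbf{B}$ is nilpotent of degree $6$, that is, $\mathbf{B}^6=0$ and $\mathbf{B}^5\neq 0$; (iii) $G$ is a free $2$-generated nilpotent group of class $4$: it is nilpotent of class exactly $4$, and $y_i\gamma_5(F_2)\mapsto a_i$ $(i=1,2)$, where $a_i$ is the image of $y_i$ in $\mathbf{A}$ and $\gamma_5(F_2)$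 is the fifth term of the lower central series of $F_2$ (with $\gamma_1(F_2)=F_2$), defines an isomorphism $F_2/\gamma_5(F_2)\cong G$; (iv) $(x-1)^3=0$ for every $x\in G$. -/

import Mathlib

noncomputable section

/-- The quotient `R[Γ] / ⟨(x - 1) ^ n : x ∈ S⟩` of the group ring `R[Γ]` by the two-sided ideal
generated by the elements `(x - 1) ^ n`, `x ∈ S`. -/
abbrev UnipotentQuotient (R : Type*) [CommRing R] {Γ : Type*} [Group Γ] (n : ℕ) (S : Set Γ) :
    Type _ :=
  (TwoSidedIdeal.span
    ((fun x : Γ => (MonoidAlgebra.of R Γ x - 1) ^ n) '' S)).ringCon.Quotient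

namespace UnipotentQuotient

variable (R : Type*) [CommRing R] {Γ : Type*} [Group Γ] (n : ℕ) (S : Set Γ)

/-- The canonical projection from the group ring to the quotient. -/
def proj : MonoidAlgebra R Γ →ₐ[R] UnipotentQuotient R n S :=
  RingCon.mkₐ R _

/-- The augmentation map `R[Γ] → R`, sending every group element to `1`. -/
def augmentation (R : Type*) [CommRing R] (Γ : Type*) [Group Γ] : MonoidAlgebra R Γ →ₐ[R] R :=
  MonoidAlgebra.lift R R Γ 1

/-- The image in the quotient of the augmentation ideal of `R[Γ]`. It is regarded as an
`R`-submodule, so that its `k`-th power is the `R`-span of all products of `k` of its elements. -/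
def augIdeal : Submodule R (UnipotentQuotient R n S) :=
  (LinearMap.ker (augmentation R Γ).toLinearMap).map (proj R n S).toLinearMap

/-- The canonical homomorphism from `Γ` to the group of units of the quotient. -/
def unitHom : Γ →* (UnipotentQuotient R n S)ˣ :=
  (((proj R n S : MonoidAlgebra R Γ →* UnipotentQuotient R n S)).comp
    (MonoidAlgebra.of R Γ)).toHomUnits

/-- The image of `Γ` in the group of units of the quotient. -/
def imageGroup : Subgroup (UnipotentQuotient R n S)ˣ :=
  (unitHom R n S).range

end UnipotentQuotient

/-- The free nilpotent group of class `c` on `α`: the quotient of the free group by the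
`(c + 1)`-st term `γ_{c+1}` of its lower central series (Mathlib numbers the series from `0`,
with `γ_1` as the term of index `0`). -/
abbrev FreeNilpotentGroup (α : Type*) (c : ℕ) : Type _ :=
  FreeGroup α ⧸ (⊤ : Subgroup (FreeGroup α)).lowerCentralSeries c

/-- The ring `ℤ[1/6]`. -/
abbrev ZInvSix : Type := Localization.Away (6 : ℤ)

/-- The set `P = {y₁, y₂, y₁y₂, y₁⁻¹y₂, y₁²y₂, y₁y₂², [y₁, y₂]}` in the free group on `y₁, y₂`,
where `[y₁, y₂] = y₁⁻¹y₂⁻¹y₁y₂`. -/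
def setP : Set (FreeGroup (Fin 2)) :=
  let y₁ := FreeGroup.of (0 : Fin 2)
  let y₂ := FreeGroup.of (1 : Fin 2)
  {y₁, y₂, y₁ * y₂, y₁⁻¹ * y₂, y₁ ^ 2 * y₂, y₁ * y₂ ^ 2, y₁⁻¹ * y₂⁻¹ * y₁ * y₂}

end

/-! Put `x = a₁ - 1` and `y = a₂ - 1`. As `x³ = y³ = 0`, the inverses of the generators are `1 - x +
x²` and `1 - y + y²`; so `x` and `y` generate the ring, and the relators become noncommutative
polynomials in them.

(i) A Gröbner basis computation, dividing only by divisors of 6, turns the relators into seven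
rewriting rules (`run_completionSteps`) with exactly 18 irreducible words. After one word is
corrected to respect degrees, the rules give a table of left products by `x` and `y`
(`mul_basisElem`), so the 18 elements span a left ideal containing `1` (`span_elem`). Conversely,
the table defines two endomorphisms of `R ^ 18` that satisfy the relators. The quotient therefore
acts there, and the `i`-th element carries the initial standard vector to the `i`-th one
(`linearIndependent_elem`). This replaces any confluence argument.

(ii) The basis is ordered by degree, from 0 to 5, and left multiplication by the augmentation ideal
`B` raises the degree (`augIdeal_pow_le`). The fifth power is not zero because `x²yxy` is a basis
element.

(iii) Modulo `γ₅` the free group consists of products of powers of eight basic commutators of weight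
at most 4. Their images minus `1` have non-zero leading coordinates at distinct indices, and leading
coordinates are additive. In characteristic zero a product with image `1` thus has all exponents
zero, so the kernel lies in `γ₅` (`mem_lcs_four_of_image_eq_one`). For the converse, `B⁶ = 0` makes
the image of `γ₅` central, and the commutators of weight 4 are checked to be central. Hence `γ₄` has
central image (`image_mul_comm_of_mem_lcs_three`) and `γ₅ = [γ₄, F₂]` maps to `1`.

(iv) The coordinates of degree at most 3 of an element of `G` are polynomials in five of them
(`IsGroupLike`), a property preserved by left multiplication by generators and their inverses. As
`B⁶ = 0`, only these coordinates affect `(g - 1)³`, which vanishes identically in the five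
parameters (`mulCoord_cube`). -/

/-! ### Computable noncommutative polynomials in two letters -/

/-- A word in two letters, `false` standing for the first and `true` for the second. -/
abbrev NCWord := List Bool

/-- A noncommutative polynomial in two letters with integer coefficients, as a list of terms. -/
abbrev NCPoly := List (ℤ × NCWord)

/-- Formal expressions in two letters. -/
inductive NCExpr
  | x | y | one
  | add (p q : NCExpr)
  | sub (p q : NCExpr)
  | mul (p q : NCExpr)

namespace NCWord

/-- The degree-lexicographic order, `o` being the comparison of the letters read so far. -/
def cmpAux : NCWord → NCWord → Ordering → Ordering
  | [], [], o => o
  | [], _ :: _, _ => .lt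
  | _ :: _, [], _ => .gt
  | a :: u, b :: v, .eq => cmpAux u v (if a = b then .eq else if a then .gt else .lt)
  | _ :: u, _ :: v, o => cmpAux u v o

/-- `stripPrefix u w = some r` only if `w = u ++ r`. -/
def stripPrefix : NCWord → NCWord → Option NCWord
  | [], w => some w
  | _ :: _, [] => none
  | a :: u, b :: w => if a = b then stripPrefix u w else none

/-- `findFactor u w = some (l, r)` only if `w = l ++ u ++ r`. -/
def findFactor (u : NCWord) : NCWord → Option (NCWord × NCWord)
  | [] => (stripPrefix u []).map fun r => ([], r)
  | b :: w =>
    match stripPrefix u (b :: w) with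
    | some r => some ([], r)
    | none => (findFactor u w).map fun p => (b :: p.1, p.2)

theorem stripPrefix_spec : ∀ {u w r : NCWord}, stripPrefix u w = some r → w = u ++ r
  | [], w, r, h => by simpa [stripPrefix] using h
  | _ :: _, [], r, h => by simp [stripPrefix] at h
  | a :: u, b :: w, r, h => by
    by_cases hab : a = b
    · simp only [stripPrefix, hab, if_true] at h
      rw [hab, stripPrefix_spec h, List.cons_append]
    · simp [stripPrefix, hab] at h

theorem findFactor_spec {u : NCWord} :
    ∀ {w l r : NCWord}, findFactor u w = some (l, r) → w = l ++ (u ++ r)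
  | [], l, r, h => by
    simp only [findFactor, Option.map_eq_some_iff, Prod.mk.injEq] at h
    obtain ⟨s, hs, rfl, rfl⟩ := h
    simpa using stripPrefix_spec hs
  | b :: w, l, r, h => by
    simp only [findFactor] at h
    split at h
    · rename_i s hs
      simp only [Option.some.injEq, Prod.mk.injEq] at h
      obtain ⟨rfl, rfl⟩ := h
      simpa using stripPrefix_spec hs
    · simp only [Option.map_eq_some_iff, Prod.mk.injEq, Prod.exists] at h
      obtain ⟨l', r', h', rfl, rfl⟩ := h
      simpa using findFactor_spec h'

variable {S : Type*} [Ring S] (x y : S)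

/-- The value of a word. -/
def eval : NCWord → S
  | [] => 1
  | b :: w => (bif b then y else x) * eval w

theorem eval_append (u v : NCWord) : eval x y (u ++ v) = eval x y u * eval x y v := by
  induction u with
  | nil => simp [eval]
  | cons b u ih => simp [eval, ih, mul_assoc]

end NCWord

namespace NCPoly

/-- Sum of two polynomials; a merge when both are sorted in decreasing order. -/
def add : ℕ → NCPoly → NCPoly → NCPoly
  | 0, p, q => p ++ q
  | _ + 1, [], q => q
  | _ + 1, p :: ps, [] => p :: ps
  | n + 1, (c, u) :: p, (d, v) :: q =>
    match NCWord.cmpAux u v .eq with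
    | .gt => (c, u) :: add n p ((d, v) :: q)
    | .lt => (d, v) :: add n ((c, u) :: p) q
    | .eq => if u = v then (if c + d = 0 then add n p q else (c + d, u) :: add n p q)
      else (c, u) :: add n p ((d, v) :: q)

/-- The product of a polynomial with a term on both sides. -/
def shift (c : ℤ) (l r : NCWord) (p : NCPoly) : NCPoly :=
  p.map fun t => (c * t.1, l ++ (t.2 ++ r))

/-- If the head of some monic rule occurs in `w`, the value of `w` modulo that rule. -/
def rewrite (w : NCWord) : List NCPoly → Option NCPoly
  | [] => none
  | ((1, u) :: t) :: rules =>
    match NCWord.findFactor u w with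
    | some (l, r) => some (shift (-1) l r t)
    | none => rewrite w rules
  | _ :: rules => rewrite w rules

/-- Reduction of a polynomial modulo a list of rules. -/
def reduce (rules : List NCPoly) : ℕ → NCPoly → NCPoly
  | 0, p => p
  | _ + 1, [] => []
  | n + 1, (c, w) :: p =>
    match rewrite w rules with
    | some q => reduce rules n (add 1000 p (shift c [] [] q))
    | none => (c, w) :: reduce rules n p

/-- Product of two polynomials. -/
def mul (p : NCPoly) : NCPoly → NCPoly
  | [] => []
  | (c, w) :: q => add 1000 (shift c [] w p) (mul p q)

/-- The normal form of an expression modulo a list of rules. -/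
def ofExpr (rules : List NCPoly) : NCExpr → NCPoly
  | .x => [(1, [false])]
  | .y => [(1, [true])]
  | .one => [(1, [])]
  | .add p q => add 1000 (ofExpr rules p) (ofExpr rules q)
  | .sub p q => add 1000 (ofExpr rules p) (shift (-1) [] [] (ofExpr rules q))
  | .mul p q => reduce rules 10000 (mul (ofExpr rules p) (ofExpr rules q))

/-- Division of all coefficients by `k`, which leaves a polynomial alone if not exact. -/
def divCoeff (k : ℤ) (p : NCPoly) : NCPoly :=
  if k ∣ 6 ∧ p.all fun t => k * (t.1 / k) = t.1 then p.map fun t => (t.1 / k, t.2) else p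

end NCPoly

namespace NCExpr

variable {S : Type*} [Ring S] (x y : S)

/-- The value of an expression. -/
def eval : NCExpr → S
  | .x => x
  | .y => y
  | .one => 1
  | .add p q => eval p + eval q
  | .sub p q => eval p - eval q
  | .mul p q => eval p * eval q

end NCExpr

namespace NCPoly

variable {S : Type*} [Ring S] (x y : S)

/-- The value of a polynomial. -/
def eval : NCPoly → S
  | [] => 0
  | t :: p => t.1 • NCWord.eval x y t.2 + eval p

theorem eval_append (p q : NCPoly) : eval x y (p ++ q) = eval x y p + eval x y q := by
  induction p with
  | nil => simp [eval]
  | cons t p ih => simp [eval, ih, add_assoc]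

theorem eval_add (n : ℕ) (p q : NCPoly) : eval x y (add n p q) = eval x y p + eval x y q := by
  induction n generalizing p q with
  | zero => exact eval_append x y p q
  | succ n ih =>
    match p, q with
    | [], q => simp [add, eval]
    | t :: p, [] => simp [add, eval]
    | (c, u) :: p, (d, v) :: q =>
      simp only [add]
      split
      · simp only [eval, ih]; abel
      · simp only [eval, ih]; abel
      · split_ifs with h h'
        · have : c • NCWord.eval x y u + d • NCWord.eval x y u = 0 := by
            rw [← add_smul, h', zero_smul]
          simp only [eval, ih, ← h]
          rw [add_add_add_comm, this, zero_add]
        · simp only [eval, ih, ← h, add_smul]; abel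
        · simp only [eval, ih]; abel

theorem eval_shift (c : ℤ) (l r : NCWord) (p : NCPoly) :
    eval x y (shift c l r p) = c • (NCWord.eval x y l * eval x y p * NCWord.eval x y r) := by
  induction p with
  | nil => simp [shift, eval]
  | cons t p ih =>
    simp only [shift, List.map_cons, eval, NCWord.eval_append] at ih ⊢
    rw [ih]
    simp only [mul_add, add_mul, smul_add, mul_smul_comm, smul_mul_assoc, smul_smul, mul_assoc]

/-- A vanishing monic polynomial `u + t` gives `u = -t` in the ring, so a factor `u` of a word may
be replaced by `-t`. -/
theorem rewrite_spec {w : NCWord} :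
    ∀ {rules : List NCPoly} {q : NCPoly}, (∀ p ∈ rules, eval x y p = 0) →
      rewrite w rules = some q → eval x y q = NCWord.eval x y w
  | [], q, _, h => by simp [rewrite] at h
  | p :: rules, q, hr, h => by
    have ih := fun h' => rewrite_spec (w := w) (rules := rules) (q := q)
      (fun p hp => hr p (List.mem_cons_of_mem _ hp)) h'
    unfold rewrite at h
    split at h
    · simp at *
    · rename_i u t rs heq
      simp only [List.cons.injEq] at heq
      obtain ⟨rfl, rfl⟩ := heq
      split at h
      · rename_i l r hf
        have h0 := hr _ List.mem_cons_self
        simp only [eval, one_smul] at h0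
        simp only [Option.some.injEq] at h
        rw [← h, eval_shift, NCWord.findFactor_spec hf, NCWord.eval_append, NCWord.eval_append,
          eq_neg_of_add_eq_zero_left h0]
        simp [mul_assoc]
      · exact ih h
    · rename_i heq
      simp only [List.cons.injEq] at heq
      obtain ⟨-, rfl⟩ := heq
      exact ih h

/-- Soundness holds for every amount of fuel: an interrupted reduction is merely incomplete. Neither
termination nor confluence enters. -/
theorem eval_reduce {rules : List NCPoly} (hr : ∀ p ∈ rules, eval x y p = 0) (n : ℕ) (p : NCPoly) :
    eval x y (reduce rules n p) = eval x y p := by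
  induction n generalizing p with
  | zero => rfl
  | succ n ih =>
    match p with
    | [] => rfl
    | (c, w) :: p =>
      simp only [reduce]
      split
      · rename_i q hq
        rw [ih, eval_add, eval_shift, rewrite_spec x y hr hq]
        simp [NCWord.eval, eval, add_comm]
      · simp [eval, ih]

theorem eval_mul (p q : NCPoly) : eval x y (mul p q) = eval x y p * eval x y q := by
  induction q with
  | nil => simp [mul, eval]
  | cons t q ih =>
    simp [mul, eval, eval_add, eval_shift, ih, mul_add, NCWord.eval, -zsmul_eq_mul]

theorem eval_ofExpr {rules : List NCPoly} (hr : ∀ p ∈ rules, eval x y p = 0) (e : NCExpr) :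
    eval x y (ofExpr rules e) = e.eval x y := by
  induction e with
  | x => simp [ofExpr, eval, NCExpr.eval, NCWord.eval]
  | y => simp [ofExpr, eval, NCExpr.eval, NCWord.eval]
  | one => simp [ofExpr, eval, NCExpr.eval, NCWord.eval]
  | add p q hp hq => simp [ofExpr, eval_add, NCExpr.eval, hp, hq]
  | sub p q hp hq =>
    simp [ofExpr, eval_add, eval_shift, NCExpr.eval, hp, hq, sub_eq_add_neg, NCWord.eval]
  | mul p q hp hq => simp [ofExpr, eval_reduce x y hr, eval_mul, NCExpr.eval, hp, hq]

/-- If `6 = k * m`, six times the divided polynomial has the value of `m • p`, which is zero; the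
absence of 6-torsion removes the factor. -/
theorem eval_divCoeff (h6 : ∀ a : S, (6 : ℤ) • a = 0 → a = 0) (k : ℤ) {p : NCPoly}
    (hp : eval x y p = 0) : eval x y (divCoeff k p) = 0 := by
  unfold divCoeff
  split_ifs with h
  · obtain ⟨⟨m, hm⟩, h⟩ := h
    have key : k • eval x y (p.map fun t => (t.1 / k, t.2)) = eval x y p := by
      clear hp
      induction p with
      | nil => simp [eval]
      | cons t p ih =>
        simp only [List.all_cons, Bool.and_eq_true, decide_eq_true_eq] at h
        simp only [List.map_cons, eval, smul_add, smul_smul, h.1, ih h.2]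
    apply h6
    rw [hm, mul_comm, mul_smul, key, hp, smul_zero]
  · exact hp

end NCPoly

/-! ### Completion of a set of relators -/

/-- The origin of a new rule: a relator, a difference `p * r - l * q` of two earlier polynomials
that cancels their leading words, or an earlier polynomial to be reduced again. -/
inductive CompletionSource
  | relator (e : NCExpr)
  | overlap (i j : ℕ) (r l : NCWord)
  | again (i : ℕ)

namespace Completion

/-- The state of a completion: all polynomials found so far, and the current rules. -/
abbrev State := List NCPoly × List NCPoly

/-- The polynomial described by a source. -/
def source (s : State) : CompletionSource → NCPoly
  | .relator e => NCPoly.ofExpr s.2 e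
  | .overlap i j r l => NCPoly.add 1000 (NCPoly.shift 1 [] r (s.1.getD i []))
      (NCPoly.shift (-1) l [] (s.1.getD j []))
  | .again i => s.1.getD i []

/-- Whether the leading word of `p` does not contain that of `q`. -/
def isReduced (q p : NCPoly) : Bool :=
  match p, q with
  | (_, u) :: _, (_, w) :: _ => (NCWord.findFactor w u).isNone
  | _, _ => true

/-- One step of a completion: reduce a polynomial and divide it by `k`. -/
def step (s : State) (t : ℤ × CompletionSource) : State :=
  let p := NCPoly.divCoeff t.1 (NCPoly.reduce s.2 10000 (source s t.2))
  (s.1 ++ [p], s.2.filter (isReduced p) ++ [p])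

/-- The rules found by a sequence of steps. -/
def run (ts : List (ℤ × CompletionSource)) : State :=
  ts.foldl step ([], [])

variable {S : Type*} [Ring S] {x y : S}

theorem eval_source {s : State} (h₁ : ∀ p ∈ s.1, NCPoly.eval x y p = 0)
    (h₂ : ∀ p ∈ s.2, NCPoly.eval x y p = 0) {t : CompletionSource}
    (ht : ∀ e, t = .relator e → e.eval x y = 0) : NCPoly.eval x y (source s t) = 0 := by
  have hget (i : ℕ) : NCPoly.eval x y (s.1.getD i []) = 0 := by
    by_cases hi : i < s.1.length
    · rw [List.getD_eq_getElem _ _ hi]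
      exact h₁ _ (List.getElem_mem hi)
    · rw [List.getD_eq_default _ _ (not_lt.mp hi)]
      rfl
  cases t with
  | relator e => rw [source, NCPoly.eval_ofExpr x y h₂, ht e rfl]
  | overlap i j r l =>
    simp only [source, NCPoly.eval_add, NCPoly.eval_shift, hget, mul_zero, zero_mul, smul_zero,
      add_zero]
  | again i => exact hget i

theorem eval_step (h6 : ∀ a : S, (6 : ℤ) • a = 0 → a = 0) {s : State}
    (h₁ : ∀ p ∈ s.1, NCPoly.eval x y p = 0) (h₂ : ∀ p ∈ s.2, NCPoly.eval x y p = 0)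
    {t : ℤ × CompletionSource} (ht : ∀ e, t.2 = .relator e → e.eval x y = 0) :
    (∀ p ∈ (step s t).1, NCPoly.eval x y p = 0) ∧ ∀ p ∈ (step s t).2, NCPoly.eval x y p = 0 := by
  have hp := NCPoly.eval_divCoeff x y h6 t.1
    ((NCPoly.eval_reduce x y h₂ 10000 _).trans (eval_source h₁ h₂ ht))
  constructor
  · intro p hp'
    rcases List.mem_append.mp hp' with h | h
    · exact h₁ p h
    · rw [List.mem_singleton.mp h]
      exact hp
  · intro p hp'
    rcases List.mem_append.mp hp' with h | h
    · exact h₂ p (List.mem_of_mem_filter h)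
    · rw [List.mem_singleton.mp h]
      exact hp

/-- A completion only finds consequences of its relators, up to `6`-torsion. -/
theorem eval_run (h6 : ∀ a : S, (6 : ℤ) • a = 0 → a = 0) (ts : List (ℤ × CompletionSource))
    (hts : ∀ t ∈ ts, ∀ e, t.2 = .relator e → e.eval x y = 0) :
    ∀ p ∈ (run ts).2, NCPoly.eval x y p = 0 := by
  suffices h : ∀ s : State, (∀ p ∈ s.1, NCPoly.eval x y p = 0) →
      (∀ p ∈ s.2, NCPoly.eval x y p = 0) → (∀ p ∈ (ts.foldl step s).2, NCPoly.eval x y p = 0) from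
    h _ (by simp) (by simp)
  induction ts with
  | nil => exact fun s _ h₂ => h₂
  | cons t ts ih =>
    intro s h₁ h₂
    have h := eval_step h6 h₁ h₂ (hts t List.mem_cons_self)
    exact ih (fun t ht => hts t (List.mem_cons_of_mem _ ht)) _ h.1 h.2

end Completion

namespace NCExpr

/-- `x ^ 3`. -/
def cube (e : NCExpr) : NCExpr := .mul (.mul e e) e

/-- The first generator of the group, for `x` one less than it. -/
def a : NCExpr := .add .one .x

/-- The second generator of the group. -/
def b : NCExpr := .add .one .y

/-- The inverse of the first generator if `x ^ 3 = 0`. -/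
def aInv : NCExpr := .add (.sub .one .x) (.mul .x .x)

/-- The inverse of the second generator if `y ^ 3 = 0`. -/
def bInv : NCExpr := .add (.sub .one .y) (.mul .y .y)

/-- The expressions `u - 1` for `u` in the set `P`. -/
def gens : List NCExpr :=
  [.x, .y, .sub (.mul a b) .one, .sub (.mul aInv b) .one, .sub (.mul (.mul a a) b) .one,
    .sub (.mul a (.mul b b)) .one, .sub (.mul (.mul (.mul aInv bInv) a) b) .one]

end NCExpr

/-- The completion of the relators `(u - 1) ^ 3`, `u ∈ P`. -/
def completionSteps : List (ℤ × CompletionSource) :=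
  let x := false
  let y := true
  let rel (i : ℕ) : CompletionSource := .relator (NCExpr.cube (NCExpr.gens.getD i .x))
  [(1, rel 0), (1, rel 1), (1, rel 2),
    (-1, .overlap 0 2 [y, x, y, x, y] [x, x]), (1, .overlap 3 1 [y, y] [y, x, y, x]),
    (1, .overlap 1 3 [x, y, x, y] [y, y]), (1, rel 3), (3, rel 4), (1, rel 5),
    (-1, .overlap 0 6 [y, x, x, y, x, x, y] [x]), (1, .again 6),
    (1, .overlap 10 1 [y, y] [y, x, x, y, x, x]), (1, .overlap 11 0 [x] [y, x, x, y]),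
    (1, .overlap 5 12 [y] [y]), (-1, .overlap 12 1 [y, y] [y, x, x]),
    (3, .overlap 4 12 [x, y] [y, x]), (-1, .overlap 14 1 [y] [x, y, y, x]),
    (-6, .overlap 1 11 [x, x, y, x, x] [y, y]), (1, .overlap 10 9 [x, y] [y]),
    (1, .again 9), (-1, .again 15), (3, .overlap 8 1 [y] [x, y, y, x, y, y, x]),
    (3, .again 8), (-6, rel 6)]

/-! ### Integer coordinate vectors -/

/-- A list of integer coordinates, zero beyond its length. -/
abbrev CoordVec := List ℤ

namespace CoordVec

/-- Sum of coordinate vectors. -/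
def add : CoordVec → CoordVec → CoordVec
  | [], m => m
  | c :: l, [] => c :: l
  | c :: l, d :: m => (c + d) :: add l m

/-- Multiple of a coordinate vector. -/
def smul (c : ℤ) (l : CoordVec) : CoordVec := l.map (c * ·)

/-- The image of a coordinate vector under the linear map with columns `ts`. -/
def apply : List CoordVec → CoordVec → CoordVec
  | [], _ => []
  | _ :: _, [] => []
  | t :: ts, c :: l => if c = 0 then apply ts l else add (smul c t) (apply ts l)

/-- The vector with entries `t.2` at the positions `t.1`, `t ∈ s`. -/
def ofSparse (s : List (ℕ × ℤ)) : CoordVec :=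
  s.foldr (fun t l => add (List.replicate t.1 0 ++ [t.2]) l) []

/-- Whether all coordinates vanish. -/
def isZero (l : CoordVec) : Bool := l.all (· = 0)

variable {M : Type*} [AddCommGroup M]

/-- The linear combination of the `e i` with coordinates `l`. -/
def lin (e : ℕ → M) : CoordVec → M
  | [] => 0
  | c :: l => c • e 0 + lin (fun i => e (i + 1)) l

theorem lin_add (e : ℕ → M) (l m : CoordVec) : lin e (add l m) = lin e l + lin e m := by
  induction l generalizing m e with
  | nil => simp [add, lin]
  | cons c l ih =>
    cases m with
    | nil => simp [add, lin]
    | cons d m => simp only [add, lin, ih, add_smul]; abel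

theorem lin_smul (e : ℕ → M) (c : ℤ) (l : CoordVec) : lin e (smul c l) = c • lin e l := by
  induction l generalizing e with
  | nil => simp [smul, lin]
  | cons d l ih =>
    have := ih fun i => e (i + 1)
    simp only [smul] at this
    simp only [smul, lin, List.map_cons, this, smul_add, mul_smul]

theorem lin_zero (l : CoordVec) : lin (fun _ => (0 : M)) l = 0 := by
  induction l with
  | nil => rfl
  | cons c l ih => simp [lin, ih]

theorem lin_map {N F : Type*} [AddCommGroup N] [FunLike F M N] [AddMonoidHomClass F M N] (f : F)
    (e : ℕ → M) (l : CoordVec) : f (lin e l) = lin (fun i => f (e i)) l := by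
  induction l generalizing e with
  | nil => simp [lin]
  | cons c l ih => simp only [lin, map_add, map_zsmul, ih]

theorem lin_apply (e f : ℕ → M) (ts : List CoordVec) (h : ∀ i, f i = lin e (ts.getD i []))
    (l : CoordVec) : lin f l = lin e (apply ts l) := by
  induction ts generalizing f l with
  | nil =>
    have : f = fun _ => 0 := by
      funext i
      simpa [lin] using h i
    rw [this, lin_zero]
    rfl
  | cons t ts ih =>
    cases l with
    | nil => rfl
    | cons c l =>
      have h0 : f 0 = lin e t := h 0
      have h1 := ih (fun i => f (i + 1)) (fun i => h (i + 1)) l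
      simp only [apply, lin]
      split_ifs with hc
      · rw [hc, zero_smul, zero_add, h1]
      · rw [lin_add, lin_smul, h1, h0]

theorem lin_eq_zero (e : ℕ → M) {l : CoordVec} (h : l.isZero = true) : lin e l = 0 := by
  induction l generalizing e with
  | nil => rfl
  | cons c l ih =>
    simp only [isZero, List.all_cons, Bool.and_eq_true, decide_eq_true_eq] at h
    rw [lin, h.1, zero_smul, zero_add]
    exact ih _ h.2

theorem lin_unit (e : ℕ → M) (i : ℕ) : lin e (ofSparse [(i, 1)]) = e i := by
  have (i : ℕ) (e : ℕ → M) : lin e (List.replicate i 0 ++ [1]) = e i := by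
    induction i generalizing e with
    | zero => simp [lin]
    | succ i ih => simp [lin, List.replicate_succ, ih]
  simp [ofSparse, lin_add, this, lin]

end CoordVec

/-- The action of an expression on coordinate vectors, for letters with columns `tx` and `ty`. -/
def NCExpr.act (tx ty : List CoordVec) : NCExpr → CoordVec → CoordVec
  | .x, l => CoordVec.apply tx l
  | .y, l => CoordVec.apply ty l
  | .one, l => l
  | .add p q, l => CoordVec.add (act tx ty p l) (act tx ty q l)
  | .sub p q, l => CoordVec.add (act tx ty p l) (CoordVec.smul (-1) (act tx ty q l))
  | .mul p q, l => act tx ty p (act tx ty q l)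

/-- Stated for modules because it is used twice: for the quotient ring acting on itself from the
left, and for endomorphisms acting on `R ^ 18`. Indexing by `ℕ`, with zeros beyond the basis, avoids
bounds. -/
theorem NCExpr.eval_smul_lin {S M : Type*} [Ring S] [AddCommGroup M] [Module S M] {x y : S}
    {e : ℕ → M} {tx ty : List CoordVec} (hx : ∀ i, x • e i = CoordVec.lin e (tx.getD i []))
    (hy : ∀ i, y • e i = CoordVec.lin e (ty.getD i [])) (p : NCExpr) (l : CoordVec) :
    p.eval x y • CoordVec.lin e l = CoordVec.lin e (p.act tx ty l) := by
  have letter (z : S) (t : List CoordVec) (hz : ∀ i, z • e i = CoordVec.lin e (t.getD i []))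
      (l : CoordVec) : z • CoordVec.lin e l = CoordVec.lin e (CoordVec.apply t l) := by
    rw [← CoordVec.lin_apply e (fun i => z • e i) t hz]
    exact CoordVec.lin_map (DistribSMul.toAddMonoidHom M z) e l
  induction p generalizing l with
  | x => exact letter x tx hx l
  | y => exact letter y ty hy l
  | one => exact one_smul S _
  | add p q hp hq => rw [eval, add_smul, hp, hq, act, CoordVec.lin_add]
  | sub p q hp hq =>
    rw [eval, sub_smul, hp, hq, act, CoordVec.lin_add, CoordVec.lin_smul, neg_smul, one_smul,
      sub_eq_add_neg]
  | mul p q hp hq => rw [eval, mul_smul, hq, hp, act]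

/-! ### The multiplication table -/

/-- The rules defining the quotient ring. -/
def quotientRules : List NCPoly :=
  let x := false
  let y := true
  [[(1, [x, x, x])], [(1, [y, y, y])],
    [(1, [y, x, y, x]), (-1, [x, x, y, y]), (1, [y, y, x]), (1, [y, x, y]), (1, [y, x, x]),
      (1, [x, y, y]), (1, [x, y, x]), (1, [x, x, y])],
    [(1, [y, x, x, y]), (-1, [x, y, y, x]), (-1, [y, y, x]), (-1, [y, x, y]), (1, [y, x, x]),
      (-1, [x, y, y]), (1, [x, y, x]), (1, [x, x, y])],
    [(1, [x, y, x, x]), (1, [x, x, y, x])],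
    [(1, [y, y, x]), (1, [y, x, y]), (-1, [y, x, x]), (1, [x, y, y]), (-1, [x, y, x]),
      (-1, [x, x, y])],
    [(1, [x, x, y, x, y, y])]]

/-- A basis of the quotient ring, adapted to the powers of the augmentation ideal: the ranges
`1-2`, `3-6`, `7-10`, `11-15`, `16-17` of indices are in degrees `1`, …, `5`. -/
def basisPolys : List NCPoly :=
  let x := false
  let y := true
  [[(1, [])], [(1, [x])], [(1, [y])], [(1, [x, x])], [(1, [x, y])], [(1, [y, x])], [(1, [y, y])],
    [(1, [x, x, y])], [(1, [x, y, x])], [(1, [x, y, y])], [(1, [y, x, y])],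
    -- The third and sixth rules give `2 * (yx² + xyx + x²y) = x²y² - yxyx`, so this sum has degree
    -- four in the filtration; it takes the place of the word `yxx`.
    [(1, [y, x, x]), (1, [x, y, x]), (1, [x, x, y])],
    [(1, [x, x, y, x])], [(1, [x, x, y, y])], [(1, [x, y, x, y])], [(1, [y, x, y, y])],
    [(1, [x, x, y, x, y])], [(1, [x, y, x, y, y])]]

/-- The products of the first letter with the basis elements. -/
def tableX : List CoordVec :=
  [[(1, 1)], [(3, 1)], [(4, 1)], [], [(7, 1)], [(8, 1)], [(9, 1)], [], [(12, 1)], [(13, 1)],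
    [(14, 1)], [], [], [], [(16, 1)], [(17, 1)]].map CoordVec.ofSparse

/-- The products of the second letter with the basis elements. -/
def tableY : List CoordVec :=
  [[(2, 1)], [(5, 1)], [(6, 1)], [(7, -1), (8, -1), (11, 1)], [(10, 1)],
    [(9, -1), (10, -1), (11, 1)], [], [(13, -1), (14, -1)], [(11, -2), (13, 1)], [(15, 1)],
    [(15, -1)], [], [(16, 1)], [(17, -1)]].map CoordVec.ofSparse

-- The recorded Gröbner basis computation is replayed. Only its soundness is used; that no relation
-- is missing follows from `linearIndependent_elem`.
set_option maxRecDepth 100000 in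
theorem run_completionSteps : (Completion.run completionSteps).2 = quotientRules := by
  decide +kernel

/-- A linear combination of the basis polynomials. -/
def NCPoly.ofCoordVec : List NCPoly → CoordVec → NCPoly
  | [], _ => []
  | _ :: _, [] => []
  | p :: ps, c :: l =>
    if c = 0 then ofCoordVec ps l
    else NCPoly.add 1000 (NCPoly.shift c [] [] p) (ofCoordVec ps l)

theorem NCPoly.eval_ofCoordVec {S : Type*} [Ring S] (x y : S) (ps : List NCPoly) (l : CoordVec) :
    NCPoly.eval x y (ofCoordVec ps l) =
      CoordVec.lin (fun i => NCPoly.eval x y (ps.getD i [])) l := by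
  induction ps generalizing l with
  | nil => simp [ofCoordVec, NCPoly.eval, CoordVec.lin_zero]
  | cons p ps ih =>
    cases l with
    | nil => rfl
    | cons c l =>
      rw [ofCoordVec]
      split_ifs with hc
      · simp [hc, CoordVec.lin, ih]
      · simp [NCPoly.eval_add, NCPoly.eval_shift, CoordVec.lin, ih, NCWord.eval]

/-- The difference between a letter times a basis element and its entry in a table, reduced. -/
def tableDefect (b : Bool) (t : List CoordVec) (i : ℕ) : NCPoly :=
  NCPoly.reduce quotientRules 1000 (NCPoly.add 1000 (NCPoly.shift 1 [b] [] (basisPolys.getD i []))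
    (NCPoly.shift (-1) [] [] (NCPoly.ofCoordVec basisPolys (t.getD i []))))

theorem tableDefect_eq_nil :
    ∀ i < 18, tableDefect false tableX i = [] ∧ tableDefect true tableY i = [] := by
  decide +kernel

section Table

variable {S : Type*} [Ring S] {x y : S}

/-- The elements of `basisPolys` in a ring with two marked elements, and zero beyond. -/
def basisElem (x y : S) (i : ℕ) : S := NCPoly.eval x y (basisPolys.getD i [])

theorem mul_basisElem_of_tableDefect (hr : ∀ p ∈ quotientRules, NCPoly.eval x y p = 0) {b : Bool}
    {t : List CoordVec} {i : ℕ} (h : tableDefect b t i = []) :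
    (bif b then y else x) * basisElem x y i = CoordVec.lin (basisElem x y) (t.getD i []) := by
  have h' := congrArg (NCPoly.eval x y) h
  rw [tableDefect, NCPoly.eval_reduce x y hr, NCPoly.eval_add, NCPoly.eval_shift,
    NCPoly.eval_shift, NCPoly.eval_ofCoordVec] at h'
  simp only [NCWord.eval, mul_one, one_mul, one_smul, neg_smul, NCPoly.eval] at h'
  exact eq_of_sub_eq_zero ((sub_eq_add_neg _ _).trans h')

theorem basisElem_eq_zero (x y : S) {i : ℕ} (hi : 18 ≤ i) : basisElem x y i = 0 := by
  rw [basisElem, List.getD_eq_default _ _ hi]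
  rfl

/-- The multiplication table follows from the seven relators. -/
theorem mul_basisElem (h6 : ∀ a : S, (6 : ℤ) • a = 0 → a = 0)
    (h : ∀ e ∈ NCExpr.gens, e.eval x y ^ 3 = 0) (i : ℕ) :
    x * basisElem x y i = CoordVec.lin (basisElem x y) (tableX.getD i []) ∧
      y * basisElem x y i = CoordVec.lin (basisElem x y) (tableY.getD i []) := by
  by_cases hi : i < 18
  · have hcube (j : ℕ) (hj : j < 7) : (NCExpr.cube (NCExpr.gens.getD j .x)).eval x y = 0 := by
      rw [← h (NCExpr.gens.getD j .x)
        (by rw [List.getD_eq_getElem _ _ hj]; exact List.getElem_mem hj)]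
      simp only [NCExpr.cube, NCExpr.eval, pow_succ, pow_zero, one_mul]
    have hr : ∀ p ∈ quotientRules, NCPoly.eval x y p = 0 := by
      rw [← run_completionSteps]
      refine Completion.eval_run h6 _ fun t ht e he => ?_
      simp only [completionSteps, List.mem_cons, List.not_mem_nil, or_false] at ht
      rcases ht with rfl | rfl | rfl | rfl | rfl | rfl | rfl | rfl | rfl | rfl | rfl | rfl | rfl |
        rfl | rfl | rfl | rfl | rfl | rfl | rfl | rfl | rfl | rfl | rfl <;>
      first
        | (simp only [CompletionSource.relator.injEq] at he; rw [← he]; exact hcube _ (by decide))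
        | simp at he
    exact ⟨mul_basisElem_of_tableDefect hr (b := false) (tableDefect_eq_nil i hi).1,
      mul_basisElem_of_tableDefect hr (b := true) (tableDefect_eq_nil i hi).2⟩
  · rw [not_lt] at hi
    rw [basisElem_eq_zero x y hi, List.getD_eq_default _ _ (by exact le_trans (by decide) hi),
      List.getD_eq_default _ _ (by exact le_trans (by decide) hi)]
    simp [CoordVec.lin]

end Table

/-! ### The regular representation -/

section Model

variable (R : Type*) [CommRing R]

/-- The standard basis of `R ^ 18`, continued by zero. -/
def stdVec (i : ℕ) : Fin 18 → R :=
  if h : i < 18 then Pi.single ⟨i, h⟩ 1 else 0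

/-- The endomorphism of `R ^ 18` with the given columns. -/
noncomputable def endOfTable (t : List CoordVec) : Module.End R (Fin 18 → R) :=
  (Pi.basisFun R (Fin 18)).constr R fun i => CoordVec.lin (stdVec R) (t.getD i [])

variable {R}

theorem endOfTable_smul_stdVec {t : List CoordVec} (ht : t.length ≤ 18) (i : ℕ) :
    endOfTable R t • stdVec R i = CoordVec.lin (stdVec R) (t.getD i []) := by
  by_cases hi : i < 18
  · have := (Pi.basisFun R (Fin 18)).constr_basis R
      (fun i => CoordVec.lin (stdVec R) (t.getD i [])) ⟨i, hi⟩
    rw [Pi.basisFun_apply] at this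
    simpa only [stdVec, hi, dif_pos, endOfTable, Module.End.smul_def] using this
  · rw [List.getD_eq_default _ _ (by omega)]
    simp [stdVec, hi, CoordVec.lin]

/-- Evaluation of expressions in the regular representation is computed on coordinate vectors. -/
theorem eval_endOfTable_smul_lin (p : NCExpr) (l : CoordVec) :
    p.eval (endOfTable R tableX) (endOfTable R tableY) • CoordVec.lin (stdVec R) l =
      CoordVec.lin (stdVec R) (p.act tableX tableY l) :=
  NCExpr.eval_smul_lin (endOfTable_smul_stdVec (by decide))
    (endOfTable_smul_stdVec (by decide)) p l

/-- Vanishing on the 18 unit vectors is vanishing as endomorphisms, so the tables define a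
representation of the quotient. -/
theorem act_cube_gens : ∀ e ∈ NCExpr.gens, ∀ i < 18,
    (e.cube.act tableX tableY (CoordVec.ofSparse [(i, 1)])).isZero = true := by
  decide +kernel

theorem eval_endOfTable_gens_cube (e : NCExpr) (he : e ∈ NCExpr.gens) :
    e.eval (endOfTable R tableX) (endOfTable R tableY) ^ 3 = 0 := by
  have : e.eval (endOfTable R tableX) (endOfTable R tableY) ^ 3 =
      e.cube.eval (endOfTable R tableX) (endOfTable R tableY) := by
    simp only [NCExpr.cube, NCExpr.eval, pow_succ, pow_zero, one_mul]
  rw [this]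
  refine (Pi.basisFun R (Fin 18)).ext fun i => ?_
  have h := eval_endOfTable_smul_lin (R := R) e.cube (CoordVec.ofSparse [(i, 1)])
  rw [CoordVec.lin_eq_zero _ (act_cube_gens e he i i.2), CoordVec.lin_unit] at h
  simpa [stdVec] using h

end Model

noncomputable section

/-! ### Unipotent generators -/

theorem one_add_mul_of_cube_eq_zero {S : Type*} [Ring S] {x : S} (h : x ^ 3 = 0) :
    (1 + x) * (1 - x + x * x) = 1 := by
  have : (1 + x) * (1 - x + x * x) = 1 + x ^ 3 := by noncomm_ring
  rw [this, h, add_zero]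

theorem mul_one_add_of_cube_eq_zero {S : Type*} [Ring S] {x : S} (h : x ^ 3 = 0) :
    (1 - x + x * x) * (1 + x) = 1 := by
  have : (1 - x + x * x) * (1 + x) = 1 + x ^ 3 := by noncomm_ring
  rw [this, h, add_zero]

/-- The unit `1 + x` for `x ^ 3 = 0`. -/
def unipotentUnit {S : Type*} [Ring S] (x : S) (h : x ^ 3 = 0) : Sˣ :=
  ⟨1 + x, 1 - x + x * x, one_add_mul_of_cube_eq_zero h, mul_one_add_of_cube_eq_zero h⟩

section Evaluation

variable {S : Type*} [Ring S] (f : FreeGroup (Fin 2) →* S)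

theorem map_of_inv_of_cube_eq_zero {i : Fin 2} (h : (f (FreeGroup.of i) - 1) ^ 3 = 0) :
    f (FreeGroup.of i)⁻¹ = 1 - (f (FreeGroup.of i) - 1) +
      (f (FreeGroup.of i) - 1) * (f (FreeGroup.of i) - 1) := by
  refine left_inv_eq_right_inv (a := f (FreeGroup.of i)) ?_ ?_
  · rw [← map_mul, inv_mul_cancel, map_one]
  · have := one_add_mul_of_cube_eq_zero h
    rwa [add_sub_cancel] at this

theorem eval_a : NCExpr.a.eval (f (FreeGroup.of 0) - 1) (f (FreeGroup.of 1) - 1) =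
    f (FreeGroup.of 0) := by
  simp [NCExpr.a, NCExpr.eval]

theorem eval_b : NCExpr.b.eval (f (FreeGroup.of 0) - 1) (f (FreeGroup.of 1) - 1) =
    f (FreeGroup.of 1) := by
  simp [NCExpr.b, NCExpr.eval]

variable {f}

theorem eval_aInv (h : (f (FreeGroup.of 0) - 1) ^ 3 = 0) :
    NCExpr.aInv.eval (f (FreeGroup.of 0) - 1) (f (FreeGroup.of 1) - 1) =
      f (FreeGroup.of 0)⁻¹ :=
  (map_of_inv_of_cube_eq_zero f h).symm

theorem eval_bInv (h : (f (FreeGroup.of 1) - 1) ^ 3 = 0) :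
    NCExpr.bInv.eval (f (FreeGroup.of 0) - 1) (f (FreeGroup.of 1) - 1) =
      f (FreeGroup.of 1)⁻¹ :=
  (map_of_inv_of_cube_eq_zero f h).symm

/-- The expressions `gens` take the values `g - 1`, `g ∈ P`. -/
theorem forall_setP_iff (h₀ : (f (FreeGroup.of 0) - 1) ^ 3 = 0)
    (h₁ : (f (FreeGroup.of 1) - 1) ^ 3 = 0) :
    (∀ g ∈ setP, (f g - 1) ^ 3 = 0) ↔
      ∀ e ∈ NCExpr.gens, e.eval (f (FreeGroup.of 0) - 1) (f (FreeGroup.of 1) - 1) ^ 3 = 0 := by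
  simp only [setP, Set.mem_insert_iff, Set.mem_singleton_iff, forall_eq_or_imp, forall_eq,
    NCExpr.gens, List.mem_cons, List.not_mem_nil, or_false, NCExpr.eval, eval_a, eval_b,
    eval_aInv h₀, eval_bInv h₁, pow_two, map_mul]

end Evaluation

/-! ### The universal property of the quotient, and its basis. -/

namespace UnipotentQuotient

section General

variable {R : Type*} [CommRing R] {Γ : Type*} [Group Γ] {n : ℕ} {S : Set Γ}

theorem proj_surjective : Function.Surjective (proj R n S) :=
  RingCon.mkₐ_surjective _

theorem proj_of_sub_one_pow {g : Γ} (hg : g ∈ S) :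
    (proj R n S (MonoidAlgebra.of R Γ g) - 1) ^ n = 0 := by
  rw [← map_one (proj R n S), ← map_sub, ← map_pow, ← map_zero (proj R n S)]
  exact (RingCon.eq _).mpr ((TwoSidedIdeal.mem_iff _ _).mp
    (TwoSidedIdeal.subset_span (Set.mem_image_of_mem _ hg)))

theorem exists_lift {T : Type*} [Ring T] [Algebra R T] (f : Γ →* T)
    (hf : ∀ g ∈ S, (f g - 1) ^ n = 0) :
    ∃ φ : UnipotentQuotient R n S →ₐ[R] T, ∀ g, φ (proj R n S (MonoidAlgebra.of R Γ g)) = f g := by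
  have hle : TwoSidedIdeal.span ((fun x : Γ => (MonoidAlgebra.of R Γ x - 1) ^ n) '' S) ≤
      TwoSidedIdeal.ker (MonoidAlgebra.lift R T Γ f) := by
    rw [TwoSidedIdeal.span_le]
    rintro _ ⟨g, hg, rfl⟩
    simp only [SetLike.mem_coe, TwoSidedIdeal.mem_ker, map_pow, map_sub, map_one,
      MonoidAlgebra.lift_of]
    exact hf g hg
  refine ⟨RingCon.liftₐ _ (MonoidAlgebra.lift R T Γ f) fun x y h => ?_, fun g => ?_⟩
  · have h' := hle ((TwoSidedIdeal.rel_iff _ _ _).mp h)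
    rw [TwoSidedIdeal.mem_ker, map_sub, sub_eq_zero] at h'
    exact h'
  · exact MonoidAlgebra.lift_of _ _

end General

variable (R : Type*) [CommRing R]

/-- The image of an element of the free group in the quotient ring. -/
def image : FreeGroup (Fin 2) →* UnipotentQuotient R 3 setP :=
  ((proj R 3 setP : MonoidAlgebra R (FreeGroup (Fin 2)) →* UnipotentQuotient R 3 setP)).comp
    (MonoidAlgebra.of R (FreeGroup (Fin 2)))

theorem coe_unitHom (g : FreeGroup (Fin 2)) : (unitHom R 3 setP g : UnipotentQuotient R 3 setP) =
    image R g := rfl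

/-- The element `a₁ - 1`. -/
abbrev xElem : UnipotentQuotient R 3 setP := image R (FreeGroup.of 0) - 1

/-- The element `a₂ - 1`. -/
abbrev yElem : UnipotentQuotient R 3 setP := image R (FreeGroup.of 1) - 1

theorem xElem_cube : xElem R ^ 3 = 0 := proj_of_sub_one_pow (by simp [setP])

theorem yElem_cube : yElem R ^ 3 = 0 := proj_of_sub_one_pow (by simp [setP])

theorem image_induction {p : UnipotentQuotient R 3 setP → Prop} (u : UnipotentQuotient R 3 setP)
    (h : ∀ g, p (image R g)) (hadd : ∀ u v, p u → p v → p (u + v))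
    (hsmul : ∀ (r : R) u, p u → p (r • u)) : p u := by
  obtain ⟨f, rfl⟩ := proj_surjective u
  induction f using MonoidAlgebra.induction_on with
  | of g => exact h g
  | add f g hf hg => rw [map_add]; exact hadd _ _ hf hg
  | smul r f hf => rw [map_smul]; exact hsmul _ _ hf

variable {R}

/-- The elements of the basis, continued by zero. -/
abbrev elem (i : ℕ) : UnipotentQuotient R 3 setP := basisElem (xElem R) (yElem R) i

theorem zsmul_six_eq_zero (h6 : IsUnit (6 : R)) {M : Type*} [AddCommGroup M] [Module R M] (a : M)
    (h : (6 : ℤ) • a = 0) : a = 0 := by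
  obtain ⟨u, hu⟩ := h6
  have : (6 : R) • a = 0 := by
    rw [← h, ← Int.cast_smul_eq_zsmul R]
    norm_num
  rw [← hu] at this
  exact (smul_eq_zero_iff_eq u).mp this

theorem mul_elem (h6 : IsUnit (6 : R)) (i : ℕ) :
    xElem R * elem i = CoordVec.lin elem (tableX.getD i []) ∧
      yElem R * elem i = CoordVec.lin elem (tableY.getD i []) :=
  mul_basisElem (zsmul_six_eq_zero h6)
    ((forall_setP_iff (xElem_cube R) (yElem_cube R)).mp fun _ hg => proj_of_sub_one_pow hg) i

/-- Evaluation of expressions in the quotient ring is computed on coordinate vectors. -/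
theorem eval_mul_lin (h6 : IsUnit (6 : R)) (p : NCExpr) (l : CoordVec) :
    p.eval (xElem R) (yElem R) * CoordVec.lin elem l =
      CoordVec.lin elem (p.act tableX tableY l) :=
  NCExpr.eval_smul_lin (S := UnipotentQuotient R 3 setP) (M := UnipotentQuotient R 3 setP)
    (x := xElem R) (y := yElem R) (e := elem) (tx := tableX) (ty := tableY)
    (fun i => (mul_elem h6 i).1) (fun i => (mul_elem h6 i).2) p l

theorem elem_zero : elem (R := R) 0 = 1 := by
  simp [basisElem, basisPolys, NCPoly.eval, NCWord.eval]

/-- A ring element is its left action on `1`, whose coordinate vector is `[1]`. -/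
theorem eval_eq_lin (h6 : IsUnit (6 : R)) (p : NCExpr) :
    p.eval (xElem R) (yElem R) = CoordVec.lin elem (p.act tableX tableY [1]) := by
  rw [← eval_mul_lin h6]
  simp [CoordVec.lin, elem_zero]

theorem elem_eq_zero {i : ℕ} (hi : 18 ≤ i) : elem (R := R) i = 0 := basisElem_eq_zero _ _ hi

theorem lin_mem {ι M : Type*} [AddCommGroup M] [SetLike ι M] [AddSubgroupClass ι M] (s : ι)
    (e : ℕ → M) (l : CoordVec) (h : ∀ i, l.getD i 0 ≠ 0 → e i ∈ s) : CoordVec.lin e l ∈ s := by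
  induction l generalizing e with
  | nil => exact zero_mem s
  | cons c l ih =>
    refine add_mem ?_ (ih _ fun i hi => h (i + 1) hi)
    by_cases hc : c = 0
    · rw [hc, zero_smul]
      exact zero_mem s
    · exact zsmul_mem (h 0 hc) c

theorem map_basisElem {S T : Type*} [Ring S] [Ring T] (φ : S →+* T) (x y : S) (i : ℕ) :
    φ (basisElem x y i) = basisElem (φ x) (φ y) i := by
  have hw (w : NCWord) : φ (NCWord.eval x y w) = NCWord.eval (φ x) (φ y) w := by
    induction w with
    | nil => simp [NCWord.eval]
    | cons b w ih => cases b <;> simp [NCWord.eval, ih]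
  have hp (p : NCPoly) : φ (NCPoly.eval x y p) = NCPoly.eval (φ x) (φ y) p := by
    induction p with
    | nil => simp [NCPoly.eval]
    | cons t p ih => simp only [NCPoly.eval, map_add, map_zsmul, hw, ih]
  exact hp _

/-- The span contains `1` and by the table is stable under left multiplication by `x` and `y`, hence
by the generators `1 + x`, `1 + y` and by their inverses, which are polynomials in `x` or `y`. -/
theorem span_elem (h6 : IsUnit (6 : R)) :
    Submodule.span R (Set.range fun i : Fin 18 => elem (R := R) i) = ⊤ := by
  set W := Submodule.span R (Set.range fun i : Fin 18 => elem (R := R) i)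
  have helem (i : ℕ) : elem i ∈ W := by
    by_cases hi : i < 18
    · exact Submodule.subset_span ⟨⟨i, hi⟩, rfl⟩
    · rw [elem_eq_zero (not_lt.mp hi)]
      exact zero_mem W
  have letter (z : UnipotentQuotient R 3 setP) (t : List CoordVec)
      (hz : ∀ i, z * elem i = CoordVec.lin elem (t.getD i [])) (u : UnipotentQuotient R 3 setP)
      (hu : u ∈ W) : z * u ∈ W := by
    induction hu using Submodule.span_induction with
    | mem u hu =>
      obtain ⟨i, rfl⟩ := hu
      simp only [hz]
      exact lin_mem W _ _ fun i _ => helem i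
    | zero => rw [mul_zero]; exact zero_mem W
    | add u v _ _ hu hv => rw [mul_add]; exact add_mem hu hv
    | smul r u _ hu => rw [mul_smul_comm]; exact W.smul_mem r hu
  have hgen (i : Fin 2) (u : UnipotentQuotient R 3 setP) (hu : u ∈ W) :
      (image R (FreeGroup.of i) - 1) * u ∈ W := by
    fin_cases i
    · exact letter _ _ (fun i => (mul_elem h6 i).1) u hu
    · exact letter _ _ (fun i => (mul_elem h6 i).2) u hu
  have hcube (i : Fin 2) : (image R (FreeGroup.of i) - 1) ^ 3 = 0 := by
    fin_cases i
    · exact xElem_cube R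
    · exact yElem_cube R
  have hg (g : FreeGroup (Fin 2)) : ∀ u ∈ W, image R g * u ∈ W := by
    induction g using FreeGroup.induction_on with
    | C1 => intro u hu; rwa [map_one, one_mul]
    | of i =>
      intro u hu
      rw [← sub_add_cancel (image R (FreeGroup.of i)) 1, add_mul, one_mul]
      exact add_mem (hgen i u hu) hu
    | inv_of i _ =>
      intro u hu
      rw [map_of_inv_of_cube_eq_zero _ (hcube i), add_mul, sub_mul, one_mul, mul_assoc]
      exact add_mem (sub_mem hu (hgen i u hu)) (hgen i _ (hgen i u hu))
    | mul g h hg hh =>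
      intro u hu
      rw [map_mul, mul_assoc]
      exact hg _ (hh u hu)
  refine eq_top_iff.mpr fun u _ => image_induction R u (fun g => ?_) (fun _ _ => add_mem)
    fun r _ => W.smul_mem r
  rw [← mul_one (image R g), ← elem_zero]
  exact hg g _ (helem 0)

/-- The action of a polynomial on coordinate vectors. -/
def _root_.NCPoly.act (tx ty : List CoordVec) : NCPoly → CoordVec → CoordVec
  | [], _ => []
  | t :: p, l => CoordVec.add
      (CoordVec.smul t.1 (t.2.foldr (fun b m => CoordVec.apply (bif b then ty else tx) m) l))
      (NCPoly.act tx ty p l)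

theorem _root_.NCPoly.eval_endOfTable_smul_lin (p : NCPoly) (l : CoordVec) :
    NCPoly.eval (endOfTable R tableX) (endOfTable R tableY) p • CoordVec.lin (stdVec R) l =
      CoordVec.lin (stdVec R) (p.act tableX tableY l) := by
  have hw (w : NCWord) : NCWord.eval (endOfTable R tableX) (endOfTable R tableY) w •
      CoordVec.lin (stdVec R) l = CoordVec.lin (stdVec R)
        (w.foldr (fun b m => CoordVec.apply (bif b then tableY else tableX) m) l) := by
    induction w with
    | nil => exact one_smul _ _
    | cons b w ih =>
      rw [NCWord.eval, mul_smul, ih, List.foldr_cons]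
      cases b
      · exact _root_.eval_endOfTable_smul_lin .x _
      · exact _root_.eval_endOfTable_smul_lin .y _
  induction p with
  | nil => simp [NCPoly.eval, NCPoly.act, CoordVec.lin]
  | cons t p ih =>
    rw [NCPoly.eval, add_smul, ih, smul_assoc, hw, NCPoly.act, CoordVec.lin_add,
      CoordVec.lin_smul]

theorem act_basisPolys : ∀ i < 18, ((CoordVec.add
    ((basisPolys.getD i []).act tableX tableY (CoordVec.ofSparse [(0, 1)]))
    (CoordVec.smul (-1) (CoordVec.ofSparse [(i, 1)]))).isZero) = true := by
  decide +kernel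

/-- The quotient acts on `R ^ 18` through the tables, and the orbit map of the initial standard
vector carries these elements to the standard basis. -/
theorem linearIndependent_elem : LinearIndependent R fun i : Fin 18 => elem (R := R) i := by
  have h₀ : endOfTable R tableX ^ 3 = 0 := eval_endOfTable_gens_cube .x (by simp [NCExpr.gens])
  have h₁ : endOfTable R tableY ^ 3 = 0 := eval_endOfTable_gens_cube .y (by simp [NCExpr.gens])
  set f : FreeGroup (Fin 2) →* Module.End R (Fin 18 → R) := (Units.coeHom _).comp
    (FreeGroup.lift ![unipotentUnit (endOfTable R tableX) h₀,
      unipotentUnit (endOfTable R tableY) h₁])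
  have hx : f (FreeGroup.of 0) - 1 = endOfTable R tableX := by simp [f, unipotentUnit]
  have hy : f (FreeGroup.of 1) - 1 = endOfTable R tableY := by simp [f, unipotentUnit]
  obtain ⟨φ, hφ⟩ := exists_lift (R := R) (n := 3) (S := setP) f
    ((forall_setP_iff (by rw [hx, h₀]) (by rw [hy, h₁])).mpr fun e he => by
      rw [hx, hy]; exact eval_endOfTable_gens_cube e he)
  have hφx : φ (xElem R) = endOfTable R tableX := by
    rw [map_sub, map_one, ← hx]; exact congrArg (· - 1) (hφ _)
  have hφy : φ (yElem R) = endOfTable R tableY := by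
    rw [map_sub, map_one, ← hy]; exact congrArg (· - 1) (hφ _)
  let ψ : UnipotentQuotient R 3 setP →ₗ[R] Fin 18 → R :=
    (LinearMap.applyₗ (stdVec R 0)).comp φ.toLinearMap
  refine LinearIndependent.of_comp ψ ?_
  have : ψ ∘ (fun i : Fin 18 => elem (R := R) i) = Pi.basisFun R (Fin 18) := by
    funext i
    have h1 : ψ (elem i) = basisElem (endOfTable R tableX) (endOfTable R tableY) i •
        stdVec R 0 := by
      rw [← hφx, ← hφy]
      exact congrArg (· (stdVec R 0)) (map_basisElem φ.toRingHom _ _ i)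
    have h2 := CoordVec.lin_eq_zero (stdVec R) (act_basisPolys i i.2)
    rw [CoordVec.lin_add, CoordVec.lin_smul, CoordVec.lin_unit,
      ← NCPoly.eval_endOfTable_smul_lin, CoordVec.lin_unit, neg_smul, one_smul,
      ← sub_eq_add_neg, sub_eq_zero] at h2
    rw [Function.comp_apply, h1, basisElem, h2]
    simp [stdVec]
  rw [this]
  exact (Pi.basisFun R (Fin 18)).linearIndependent

/-- The basis of the quotient ring. -/
def basis (h6 : IsUnit (6 : R)) : Module.Basis (Fin 18) R (UnipotentQuotient R 3 setP) :=
  Module.Basis.mk linearIndependent_elem (span_elem h6).ge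

theorem basis_apply (h6 : IsUnit (6 : R)) (i : Fin 18) : basis h6 i = elem i :=
  Module.Basis.mk_apply _ _ i

end UnipotentQuotient

end

/-! ### Generators of the lower central factors of a two-generator group -/

open scoped commutatorElement

namespace Subgroup

variable {G : Type*} [Group G]

variable (G) in
/-- The lower central series of a group, starting with the whole group at index `0`. -/
abbrev lcs (n : ℕ) : Subgroup G := (⊤ : Subgroup G).lowerCentralSeries n

/-- Conjugation by `g` multiplies `h` by `⁅h, g⁆⁻¹`, which lies in the next term and hence in `H`.
-/
theorem normal_of_lowerCentralSeries_le {H : Subgroup G} {n : ℕ} (h₁ : lcs G (n + 1) ≤ H)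
    (h₂ : H ≤ lcs G n) : H.Normal := by
  refine ⟨fun h hh g => ?_⟩
  have : ⁅h, g⁆ ∈ lcs G (n + 1) := commutator_mem_commutator (h₂ hh) (mem_top g)
  have h3 : g * h * g⁻¹ = ⁅h, g⁆⁻¹ * h := by simp [commutatorElement_def, mul_assoc]
  rw [h3]
  exact mul_mem (inv_mem (h₁ this)) hh

/-- The elements that are central modulo a normal subgroup. -/
theorem exists_commutator_mem_subgroup (H : Subgroup G) [H.Normal] (S : Set G)
    (hS : closure S = ⊤) :
    ∃ C : Subgroup G, (∀ p ∈ C, ∀ q, ⁅p, q⁆ ∈ H) ∧ (∀ p, (∀ q ∈ S, ⁅p, q⁆ ∈ H) → p ∈ C) := by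
  refine ⟨(center (G ⧸ H)).comap (QuotientGroup.mk' H), fun p hp q => ?_, fun p hp => ?_⟩
  · rw [mem_comap, mem_center_iff] at hp
    rw [← QuotientGroup.eq_one_iff, ← QuotientGroup.mk'_apply, map_commutatorElement,
      commutatorElement_eq_one_iff_mul_comm]
    exact (hp _).symm
  · rw [mem_comap, mem_center_iff]
    have key : ∀ q : G, QuotientGroup.mk' H q * QuotientGroup.mk' H p =
        QuotientGroup.mk' H p * QuotientGroup.mk' H q := by
      intro q
      have hq : q ∈ closure S := hS ▸ mem_top q
      induction hq using closure_induction with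
      | mem q hq =>
        have := hp q hq
        rw [← QuotientGroup.eq_one_iff, ← QuotientGroup.mk'_apply, map_commutatorElement,
          commutatorElement_eq_one_iff_mul_comm] at this
        exact this.symm
      | one => simp
      | mul q r _ _ hq hr => rw [map_mul, mul_assoc, hr, ← mul_assoc, hq, mul_assoc]
      | inv q _ hq =>
        rw [map_inv]
        exact (Commute.inv_left (show Commute _ _ from hq)).eq
    intro g
    obtain ⟨q, rfl⟩ := QuotientGroup.mk'_surjective H g
    exact key q

/-- If `T` generates a term of the lower central series modulo the next one and `S` generates the
group, then the commutators `⁅t, s⁆` generate the next term modulo the one after it. -/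
theorem lowerCentralSeries_succ_le {S T : Set G} (hS : closure S = ⊤) {n : ℕ}
    (hT : lcs G n ≤ closure T ⊔ lcs G (n + 1)) {H : Subgroup G}
    (h₁ : lcs G (n + 2) ≤ H) (h₂ : H ≤ lcs G (n + 1))
    (h : ∀ t ∈ T, ∀ s ∈ S, ⁅t, s⁆ ∈ H) : lcs G (n + 1) ≤ H := by
  have := normal_of_lowerCentralSeries_le h₁ h₂
  obtain ⟨C, hC, hC'⟩ := exists_commutator_mem_subgroup H S hS
  refine commutator_le.mpr ?_
  refine fun p hp q _ => hC p ?_ q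
  have hle : closure T ⊔ lcs G (n + 1) ≤ C := by
    refine sup_le ((closure_le C).mpr fun t ht => hC' t (h t ht)) fun g hg => hC' g fun q _ => ?_
    exact h₁ (commutator_mem_commutator hg (mem_top q))
  exact hle (hT hp)

/-- Conjugations by `a` and `b` commute on an abelian commutator subgroup, since `⁅a, b⁆` acts
trivially there. Additively, both sides are `(1 - a)(1 - b)` applied to `⁅a, b⁆`. -/
theorem commutator_commutator_of_commute {a b : G}
    (h : ∀ p ∈ _root_.commutator G, ∀ q ∈ _root_.commutator G, p * q = q * p) :
    ⁅⁅⁅a, b⁆, a⁆, b⁆ = ⁅⁅⁅a, b⁆, b⁆, a⁆ := by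
  set c := ⁅a, b⁆ with hc
  have hcm : c ∈ _root_.commutator G := commutator_mem_commutator (mem_top a) (mem_top b)
  have hconj (g p : G) (hp : p ∈ _root_.commutator G) : g * p * g⁻¹ ∈ _root_.commutator G :=
    Normal.conj_mem inferInstance p hp g
  set u := a * c * a⁻¹ with hu
  set v := b * c * b⁻¹ with hv
  set w := b * u * b⁻¹ with hw
  have hum : u ∈ _root_.commutator G := hconj a c hcm
  have hvm : v ∈ _root_.commutator G := hconj b c hcm
  have hwm : w ∈ _root_.commutator G := hconj b u hum
  have hab : a * v * a⁻¹ = w := by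
    have h1 : a * v * a⁻¹ = c * w * c⁻¹ := by
      rw [hw, hu, hv, show c = a * b * a⁻¹ * b⁻¹ from rfl]
      group
    rw [h1, h c hcm w hwm, mul_inv_cancel_right]
  have e1 : ⁅⁅c, a⁆, b⁆ = c * u⁻¹ * (w * v⁻¹) := by
    rw [hw, hv, hu]
    simp only [commutatorElement_def]
    group
  have e2 : ⁅⁅c, b⁆, a⁆ = c * v⁻¹ * (w * u⁻¹) := by
    rw [← hab, hv, hu]
    simp only [commutatorElement_def]
    group
  clear_value w v u c
  have hui := inv_mem hum
  have hvi := inv_mem hvm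
  rw [e1, e2, h w hwm _ hvi, h w hwm _ hui, ← mul_assoc, ← mul_assoc, mul_assoc c, h _ hui _ hvi,
    ← mul_assoc c]

/-- A two-generator group of class at most `4` is metabelian. -/
theorem commute_of_mem_commutator {a b : G} (h4 : lcs G 4 = ⊥)
    (h1 : lcs G 1 ≤ zpowers ⁅a, b⁆ ⊔ lcs G 2) :
    ∀ p ∈ _root_.commutator G, ∀ q ∈ _root_.commutator G, p * q = q * p := by
  have h2 : ⁅lcs G 1, lcs G 2⁆ = ⊥ := by
    have e : ∀ n, ⁅lcs G n, (⊤ : Subgroup G)⁆ = lcs G (n + 1) := fun n => rfl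
    have e0 : lcs G 1 = ⁅(⊤ : Subgroup G), ⊤⁆ := rfl
    rw [e0]
    -- The three subgroups lemma for `⊤`, `⊤` and `γ₃`: both rotated commutators equal `γ₅ = 1`.
    refine commutator_commutator_eq_bot_of_rotate ?_ ?_
    · rw [commutator_comm ⊤, e, e, h4]
    · rw [e, e, h4]
  have hle : lcs G 2 ≤ centralizer (lcs G 1 : Set G) := by
    rw [← commutator_eq_bot_iff_le_centralizer, commutator_comm, h2]
  -- `γ₂` is generated by `⁅a, b⁆` and `γ₃`; the latter centralizes `γ₂`, and `⁅a, b⁆` commutes with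
  -- itself.
  have hle' : lcs G 1 ≤ centralizer (lcs G 1 : Set G) := by
    refine h1.trans (sup_le ?_ hle)
    rw [zpowers_le, mem_centralizer_iff]
    have : lcs G 1 ≤ centralizer {⁅a, b⁆} := by
      refine h1.trans (sup_le ?_ ?_)
      · rw [zpowers_le, mem_centralizer_singleton_iff]
      · refine hle.trans (centralizer_le ?_)
        rw [Set.singleton_subset_iff]
        exact commutator_mem_commutator (mem_top a) (mem_top b)
    intro g hg
    exact mem_centralizer_singleton_iff.mp (this hg)
  intro p hp q hq
  exact (mem_centralizer_iff.mp (hle' hp) q hq).symm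

section TwoGenerators

variable {a b : G}

theorem top_le_lowerCentralSeries_one (hab : closure {a, b} = ⊤) :
    lcs G 0 ≤ zpowers a ⊔ (zpowers b ⊔ lcs G 1) := by
  change (⊤ : Subgroup G) ≤ _
  rw [← hab, closure_le]
  rintro g (rfl | rfl)
  · exact mem_sup_left (mem_zpowers _)
  · exact mem_sup_right (mem_sup_left (mem_zpowers _))

theorem lowerCentralSeries_one_le (hab : closure {a, b} = ⊤) :
    lcs G 1 ≤ zpowers ⁅a, b⁆ ⊔ lcs G 2 := by
  have hc : ⁅a, b⁆ ∈ zpowers ⁅a, b⁆ ⊔ lcs G 2 := mem_sup_left (mem_zpowers _)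
  refine lowerCentralSeries_succ_le (n := 0) (T := {a, b}) hab (by rw [hab]; simp) le_sup_right
    (sup_le ((zpowers_le).mpr (commutator_mem_commutator (mem_top a) (mem_top b)))
      (lowerCentralSeries_antitone _ (by norm_num))) ?_
  rintro t (rfl | rfl) s (rfl | rfl)
  · rw [commutatorElement_self]; exact one_mem _
  · exact hc
  · rw [← commutatorElement_inv s t]; exact inv_mem hc
  · rw [commutatorElement_self]; exact one_mem _

theorem lowerCentralSeries_two_le (hab : closure {a, b} = ⊤) :
    lcs G 2 ≤ zpowers ⁅⁅a, b⁆, a⁆ ⊔ (zpowers ⁅⁅a, b⁆, b⁆ ⊔ lcs G 3) := by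
  have hc : ⁅a, b⁆ ∈ lcs G 1 := commutator_mem_commutator (mem_top a) (mem_top b)
  refine lowerCentralSeries_succ_le (n := 1) (T := {⁅a, b⁆}) hab
    (by rw [← zpowers_eq_closure]; exact lowerCentralSeries_one_le hab)
    (le_sup_right.trans le_sup_right)
    (sup_le ((zpowers_le).mpr (commutator_mem_commutator hc (mem_top a)))
      (sup_le ((zpowers_le).mpr (commutator_mem_commutator hc (mem_top b)))
        (lowerCentralSeries_antitone _ (by norm_num)))) ?_
  rintro t rfl s (rfl | rfl)
  · exact mem_sup_left (mem_zpowers _)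
  · exact mem_sup_right (mem_sup_left (mem_zpowers _))

/-- The quotient by `γ₅` has class at most 4, so it is metabelian and
`commutator_commutator_of_commute` applies to it. -/
theorem commutator_inv_mul_mem_lowerCentralSeries_four (hab : closure {a, b} = ⊤) :
    ⁅⁅⁅a, b⁆, a⁆, b⁆⁻¹ * ⁅⁅⁅a, b⁆, b⁆, a⁆ ∈ lcs G 4 := by
  let π := QuotientGroup.mk' (lcs G 4)
  have hπ : Function.Surjective π := QuotientGroup.mk'_surjective _
  have hmap (n : ℕ) : lcs (G ⧸ lcs G 4) n = (lcs G n).map π := by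
    rw [map_lowerCentralSeries, map_top_of_surjective π hπ]
  have hab' : closure {π a, π b} = ⊤ := by
    rw [← Set.image_pair, ← MonoidHom.map_closure, hab, map_top_of_surjective π hπ]
  have h := commutator_commutator_of_commute (a := π a) (b := π b)
    (commute_of_mem_commutator
      (by rw [hmap, map_eq_bot_iff, QuotientGroup.ker_mk']) (lowerCentralSeries_one_le hab'))
  simp only [← map_commutatorElement] at h
  exact QuotientGroup.eq.mp h

/-- Of the four commutators of weight 4 obtained from `γ₃`, `⁅⁅⁅a, b⁆, b⁆, a⁆` is redundant modulo
`γ₅`. The other three are listed by increasing `leadingIndex`, as the kernel argument requires. -/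
theorem lowerCentralSeries_three_le (hab : closure {a, b} = ⊤) :
    lcs G 3 ≤ zpowers ⁅⁅⁅a, b⁆, a⁆, b⁆ ⊔ (zpowers ⁅⁅⁅a, b⁆, a⁆, a⁆ ⊔
      (zpowers ⁅⁅⁅a, b⁆, b⁆, b⁆ ⊔ lcs G 4)) := by
  have hc : ⁅a, b⁆ ∈ lcs G 1 := commutator_mem_commutator (mem_top a) (mem_top b)
  have hd (g : G) : ⁅⁅a, b⁆, g⁆ ∈ lcs G 2 := commutator_mem_commutator hc (mem_top g)
  have hf (g h : G) : ⁅⁅⁅a, b⁆, g⁆, h⁆ ∈ lcs G 3 := commutator_mem_commutator (hd g) (mem_top h)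
  refine lowerCentralSeries_succ_le (n := 2) (T := {⁅⁅a, b⁆, a⁆, ⁅⁅a, b⁆, b⁆}) hab ?_
    (le_sup_right.trans (le_sup_right.trans le_sup_right))
    (sup_le ((zpowers_le).mpr (hf a b)) (sup_le ((zpowers_le).mpr (hf a a))
      (sup_le ((zpowers_le).mpr (hf b b)) (lowerCentralSeries_antitone _ (by norm_num))))) ?_
  · refine (lowerCentralSeries_two_le hab).trans ?_
    rw [← sup_assoc]
    refine sup_le_sup_right (sup_le ?_ ?_) _ <;> rw [zpowers_le] <;>
      exact subset_closure (by simp)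
  · rintro t (rfl | rfl) s (rfl | rfl)
    · exact mem_sup_right (mem_sup_left (mem_zpowers _))
    · exact mem_sup_left (mem_zpowers _)
    · have h := commutator_inv_mul_mem_lowerCentralSeries_four hab
      have h' := mul_mem (mem_sup_left (mem_zpowers ⁅⁅⁅s, b⁆, s⁆, b⁆))
        (mem_sup_right (mem_sup_right (mem_sup_right h :
          _ ∈ zpowers ⁅⁅⁅s, b⁆, b⁆, b⁆ ⊔ lcs G 4) :
          _ ∈ zpowers ⁅⁅⁅s, b⁆, s⁆, s⁆ ⊔ (zpowers ⁅⁅⁅s, b⁆, b⁆, b⁆ ⊔ lcs G 4)))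
      rwa [mul_inv_cancel_left] at h'
    · exact mem_sup_right (mem_sup_right (mem_sup_left (mem_zpowers _)))

end TwoGenerators

end Subgroup

noncomputable section

/-! ### The filtration by powers of the augmentation ideal -/

theorem CoordVec.lin_indicator {M : Type*} [AddCommGroup M] (l : CoordVec) (i : ℕ) (a : M) :
    lin (fun j => if j = i then a else 0) l = l.getD i 0 • a := by
  induction l generalizing i with
  | nil => simp [lin]
  | cons c l ih =>
    cases i with
    | zero => simp [lin, lin_zero]
    | succ i => simpa [lin] using ih i

namespace UnipotentQuotient

variable {R : Type*} [CommRing R] (h6 : IsUnit (6 : R))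

theorem coord_elem (i : Fin 18) (j : ℕ) :
    (basis h6).coord i (elem j) = if j = i then 1 else 0 := by
  by_cases hj : j < 18
  · have := (basis h6).repr_self_apply ⟨j, hj⟩ i
    rw [basis_apply] at this
    simpa [Fin.ext_iff] using this
  · rw [elem_eq_zero (not_lt.mp hj), map_zero, if_neg (by omega)]

theorem coord_lin (i : Fin 18) (l : CoordVec) :
    (basis h6).coord i (CoordVec.lin elem l) = (l.getD i 0 : ℤ) := by
  rw [CoordVec.lin_map]
  simp only [coord_elem]
  rw [CoordVec.lin_indicator, zsmul_eq_mul, mul_one]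

/-- The elements whose first `m` coordinates vanish. -/
def filt (m : ℕ) : Submodule R (UnipotentQuotient R 3 setP) :=
  ⨅ (i : Fin 18) (_ : (i : ℕ) < m), LinearMap.ker ((basis h6).coord i)

variable {h6}

theorem mem_filt {m : ℕ} {u : UnipotentQuotient R 3 setP} :
    u ∈ filt h6 m ↔ ∀ i : Fin 18, (i : ℕ) < m → (basis h6).coord i u = 0 := by
  simp [filt, Submodule.mem_iInf]

theorem filt_antitone : Antitone (filt h6) := fun _ _ h _ hu =>
  mem_filt.mpr fun i hi => mem_filt.mp hu i (hi.trans_le h)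

theorem lin_mem_filt {m : ℕ} {l : CoordVec} (h : ∀ i < m, l.getD i 0 = 0) :
    CoordVec.lin elem l ∈ filt h6 m :=
  mem_filt.mpr fun i hi => by rw [coord_lin, h i hi, Int.cast_zero]

theorem filt_zero : filt h6 0 = ⊤ := eq_top_iff.mpr fun _ _ => mem_filt.mpr fun _ hi =>
  absurd hi (Nat.not_lt_zero _)

theorem filt_eighteen : filt h6 18 = ⊥ := eq_bot_iff.mpr fun u hu =>
  (basis h6).ext_elem fun i => by simpa using mem_filt.mp hu i i.2

/-- The tables map the elements with `m` vanishing coordinates to ones with `m'` of them. -/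
def Raises (m m' : ℕ) : Prop :=
  m ≤ m' ∧ ∀ j < 18, m ≤ j → ∀ i < m',
    (tableX.getD j []).getD i 0 = 0 ∧ (tableY.getD j []).getD i 0 = 0

instance (m m' : ℕ) : Decidable (Raises m m') := inferInstanceAs (Decidable (_ ∧ _))

theorem sub_one_mul_mem_filt_of {m m' : ℕ} (h : Raises m m') (i : Fin 2)
    {u : UnipotentQuotient R 3 setP} (hu : u ∈ filt h6 m) :
    (image R (FreeGroup.of i) - 1) * u ∈ filt h6 m' := by
  have helem (j : Fin 18) (hj : m ≤ j) :
      (image R (FreeGroup.of i) - 1) * elem j ∈ filt h6 m' := by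
    fin_cases i
    · refine (mul_elem h6 j).1 ▸ lin_mem_filt fun i hi => (h.2 j j.2 hj i hi).1
    · refine (mul_elem h6 j).2 ▸ lin_mem_filt fun i hi => (h.2 j j.2 hj i hi).2
  rw [← (basis h6).sum_repr u, Finset.mul_sum]
  refine sum_mem fun j _ => ?_
  rw [mul_smul_comm, basis_apply]
  by_cases hj : (j : ℕ) < m
  · have : (basis h6).repr u j = 0 := mem_filt.mp hu j hj
    rw [this]
    exact (zero_smul R ((image R (FreeGroup.of i) - 1) * elem (R := R) j)).symm ▸ zero_mem _
  · exact Submodule.smul_mem _ _ (helem j (not_lt.mp hj))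

theorem image_sub_one_mul_mem_filt {m m' : ℕ} (h : Raises m m') (g : FreeGroup (Fin 2)) :
    ∀ u ∈ filt h6 m, (image R g - 1) * u ∈ filt h6 m' := by
  have hcube (i : Fin 2) : (image R (FreeGroup.of i) - 1) ^ 3 = 0 := by
    fin_cases i
    · exact xElem_cube R
    · exact yElem_cube R
  have hle : filt h6 m' ≤ filt h6 m := filt_antitone h.1
  induction g using FreeGroup.induction_on with
  | C1 => intro u _; rw [map_one, sub_self, zero_mul]; exact zero_mem _
  | of i => exact fun u hu => sub_one_mul_mem_filt_of h i hu
  | inv_of i _ =>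
    intro u hu
    rw [map_of_inv_of_cube_eq_zero _ (hcube i)]
    have h1 := sub_one_mul_mem_filt_of h i hu
    have h2 := sub_one_mul_mem_filt_of h i (hle h1)
    convert sub_mem h2 h1 using 1
    noncomm_ring
  | mul g k hg hk =>
    intro u hu
    have h1 := hk u hu
    have h2 := hg _ (hle h1)
    have h3 := hg u hu
    convert add_mem (add_mem h2 h1) h3 using 1
    rw [map_mul]
    noncomm_ring

theorem image_mul_mem_filt {m : ℕ} (h : Raises m m) (g : FreeGroup (Fin 2))
    {u : UnipotentQuotient R 3 setP} (hu : u ∈ filt h6 m) : image R g * u ∈ filt h6 m := by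
  have := add_mem (image_sub_one_mul_mem_filt h g u hu) hu
  rwa [sub_mul, one_mul, sub_add_cancel] at this

theorem augIdeal_mul_mem_filt {m m' : ℕ} (h : Raises m m') {b u : UnipotentQuotient R 3 setP}
    (hb : b ∈ augIdeal R 3 setP) (hu : u ∈ filt h6 m) : b * u ∈ filt h6 m' := by
  obtain ⟨f, hf, rfl⟩ := hb
  have key (f : MonoidAlgebra R (FreeGroup (Fin 2))) :
      proj R 3 setP f * u - augmentation R _ f • u ∈ filt h6 m' := by
    induction f using MonoidAlgebra.induction_on with
    | of g =>
      rw [augmentation, MonoidAlgebra.lift_of, MonoidHom.one_apply, one_smul]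
      convert image_sub_one_mul_mem_filt h g u hu using 1
      rw [sub_mul, one_mul]
      rfl
    | add f g hf hg =>
      convert add_mem hf hg using 1
      rw [map_add, map_add, add_mul]
      refine (congrArg _ (add_smul (augmentation R _ f) (augmentation R _ g) u)).trans ?_
      abel
    | smul r f hf =>
      convert (filt h6 m').smul_mem r hf using 1
      rw [map_smul, map_smul, smul_mul_assoc, smul_sub, smul_assoc]
  have hf' : augmentation R _ f = 0 := hf
  have := key f
  rw [hf'] at this
  convert this using 1
  exact (sub_eq_self.mpr (zero_smul R u)).symm

theorem image_sub_one_mem_augIdeal (g : FreeGroup (Fin 2)) :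
    image R g - 1 ∈ augIdeal R 3 setP := by
  refine ⟨MonoidAlgebra.of R _ g - 1, ?_, ?_⟩
  · change augmentation R _ _ = 0
    rw [map_sub, augmentation, MonoidAlgebra.lift_of, map_one, MonoidHom.one_apply, sub_self]
  · exact (map_sub (proj R 3 setP) _ _).trans (by rw [map_one]; rfl)

/-- The index of the first basis element of each degree. -/
def degreeStart (k : ℕ) : ℕ := [0, 1, 3, 7, 11, 16, 18].getD k 18

theorem raises_degreeStart : ∀ k < 6, Raises (degreeStart k) (degreeStart (k + 1)) := by
  decide +kernel

/-- Strict triangularity, finer than the grading by degree: it separates basic commutators of equal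
weight. -/
theorem raises_succ : ∀ m < 18, Raises m (m + 1) := by
  decide +kernel

theorem raises_self : ∀ m < 18, Raises m m := by
  decide +kernel

theorem augIdeal_pow_le (k : ℕ) (hk : k ≤ 6) : augIdeal R 3 setP ^ k ≤ filt h6 (degreeStart k) := by
  induction k with
  | zero => exact le_of_le_of_eq le_top filt_zero.symm
  | succ k ih =>
    refine (pow_succ' (augIdeal R 3 setP) k).trans_le (Submodule.mul_le.mpr ?_)
    exact fun b hb u hu => augIdeal_mul_mem_filt (raises_degreeStart k (by omega)) hb
      (ih (by omega) hu)

theorem augIdeal_pow_six (h6 : IsUnit (6 : R)) : augIdeal R 3 setP ^ 6 = ⊥ :=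
  eq_bot_iff.mpr ((augIdeal_pow_le (h6 := h6) 6 le_rfl).trans (filt_eighteen).le)

theorem augIdeal_pow_five_ne_bot (h6 : IsUnit (6 : R)) [Nontrivial R] :
    augIdeal R 3 setP ^ 5 ≠ ⊥ := by
  intro h
  have hx : xElem R ∈ augIdeal R 3 setP := image_sub_one_mem_augIdeal _
  have hy : yElem R ∈ augIdeal R 3 setP := image_sub_one_mem_augIdeal _
  -- This word is the basis element of index 16.
  have h5 : xElem R * (xElem R * (yElem R * (xElem R * yElem R))) ∈ augIdeal R 3 setP ^ 5 := by
    simp only [pow_succ', pow_zero, mul_one]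
    exact Submodule.mul_mem_mul hx (Submodule.mul_mem_mul hx (Submodule.mul_mem_mul hy
      (Submodule.mul_mem_mul hx hy)))
  rw [h, Submodule.mem_bot] at h5
  refine (basis h6).ne_zero (16 : Fin 18) ?_
  rw [basis_apply, ← h5]
  simp [basisElem, basisPolys, NCPoly.eval, NCWord.eval]

end UnipotentQuotient

end

noncomputable section

open scoped commutatorElement
open Subgroup (lcs zpowers)

/-! ### The kernel on the free group -/

/-- Induction through `⁅p, q⁆ - 1 = pq((p⁻¹ - 1)(q⁻¹ - 1) - (q⁻¹ - 1)(p⁻¹ - 1))`. The exponent is `k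
+ 1` because `lcs Γ k` is `γ_{k+1}`. -/
theorem sub_one_mem_pow_of_mem_lcs {R A Γ : Type*} [CommRing R] [Ring A] [Algebra R A] [Group Γ]
    (f : Γ →* A) {B : Submodule R A} (hB : B * B ≤ B) (hf : ∀ g, f g - 1 ∈ B) (k : ℕ) :
    ∀ g ∈ lcs Γ k, f g - 1 ∈ B ^ (k + 1) := by
  have hle (k : ℕ) : B ^ (k + 2) ≤ B ^ (k + 1) := by
    rw [pow_succ B (k + 1), pow_succ B k, mul_assoc]
    exact mul_le_mul_right hB _
  have hmul (k : ℕ) (g : Γ) {u : A} (hu : u ∈ B ^ (k + 1)) : f g * u ∈ B ^ (k + 1) := by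
    have : (f g - 1) * u ∈ B ^ (k + 2) := by
      rw [pow_succ' B (k + 1)]
      exact Submodule.mul_mem_mul (hf g) hu
    convert add_mem (hle k this) hu using 1
    noncomm_ring
  have hinv (g : Γ) : f g * f g⁻¹ = 1 := by rw [← map_mul, mul_inv_cancel, map_one]
  induction k with
  | zero => exact fun g _ => by rw [zero_add, pow_one]; exact hf g
  | succ k ih =>
    let D : Subgroup Γ :=
      { carrier := {g | f g - 1 ∈ B ^ (k + 2)}
        one_mem' := by simp
        mul_mem' := fun {g h} hg hh => by
          have := add_mem (hmul _ g hh) hg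
          rwa [mul_sub, mul_one, sub_add_sub_cancel, ← map_mul] at this
        inv_mem' := fun {g} hg => by
          have := neg_mem (hmul _ g⁻¹ hg)
          rwa [mul_sub, mul_one, ← map_mul, inv_mul_cancel, map_one, neg_sub] at this }
    change lcs Γ (k + 1) ≤ D
    refine Subgroup.commutator_le.mpr fun p hp q _ => ?_
    have h1 : (f p⁻¹ - 1) * (f q⁻¹ - 1) ∈ B ^ (k + 2) := by
      rw [pow_succ B (k + 1)]
      exact Submodule.mul_mem_mul (ih _ (inv_mem hp)) (hf _)
    have h2 : (f q⁻¹ - 1) * (f p⁻¹ - 1) ∈ B ^ (k + 2) := by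
      rw [pow_succ' B (k + 1)]
      exact Submodule.mul_mem_mul (hf _) (ih _ (inv_mem hp))
    have h3 := hmul _ (p * q) (sub_mem h1 h2)
    have h4 : f (p * q) * ((f p⁻¹ - 1) * (f q⁻¹ - 1) - (f q⁻¹ - 1) * (f p⁻¹ - 1)) =
        f ⁅p, q⁆ - 1 := by
      rw [show (f p⁻¹ - 1) * (f q⁻¹ - 1) - (f q⁻¹ - 1) * (f p⁻¹ - 1) =
        f p⁻¹ * f q⁻¹ - f q⁻¹ * f p⁻¹ by noncomm_ring, mul_sub, commutatorElement_def]
      simp only [← map_mul]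
      rw [← map_one f]
      congr 2 <;> group
    rwa [h4] at h3

/-- A pair of expressions for the commutator of two elements and its inverse, from such pairs for
the two elements. -/
def NCExpr.comm (p q : NCExpr × NCExpr) : NCExpr × NCExpr :=
  (.mul p.1 (.mul q.1 (.mul p.2 q.2)), .mul q.1 (.mul p.1 (.mul q.2 p.2)))

namespace UnipotentQuotient

/-! ### Expressions for group elements and their commutators. -/

section Words

variable (R : Type*) [CommRing R]

/-- A pair of expressions represents a group element if its values are the images of the element
and of its inverse. -/
def Represents (p : NCExpr × NCExpr) (g : FreeGroup (Fin 2)) : Prop :=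
  p.1.eval (xElem R) (yElem R) = image R g ∧ p.2.eval (xElem R) (yElem R) = image R g⁻¹

variable {R}

theorem Represents.comm {p q : NCExpr × NCExpr} {g h : FreeGroup (Fin 2)}
    (hp : Represents R p g) (hq : Represents R q h) :
    Represents R (NCExpr.comm p q) ⁅g, h⁆ := by
  constructor
  · simp only [NCExpr.comm, NCExpr.eval, hp.1, hp.2, hq.1, hq.2, ← map_mul]
    congr 1
    simp only [commutatorElement_def, mul_assoc]
  · simp only [NCExpr.comm, NCExpr.eval, hp.1, hp.2, hq.1, hq.2, ← map_mul]
    congr 1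
    simp only [commutatorElement_def, mul_inv_rev, inv_inv, mul_assoc]

theorem represents_a : Represents R (.a, .aInv) (FreeGroup.of 0) :=
  ⟨eval_a _, eval_aInv (xElem_cube R)⟩

theorem represents_b : Represents R (.b, .bInv) (FreeGroup.of 1) :=
  ⟨eval_b _, eval_bInv (yElem_cube R)⟩

end Words

variable {R : Type*} [CommRing R] {h6 : IsUnit (6 : R)}

theorem raises_self' (m : ℕ) : Raises m m := by
  by_cases hm : m < 18
  · exact raises_self m hm
  · exact ⟨le_rfl, fun j hj hmj => absurd hj (by omega)⟩

variable (h6) in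
/-- The elements of the free group congruent to `1` modulo a step of the filtration. -/
def congruence (m : ℕ) : Subgroup (FreeGroup (Fin 2)) where
  carrier := {g | image R g - 1 ∈ filt h6 m}
  one_mem' := by simp
  mul_mem' {g h} hg hh := by
    have := add_mem (image_mul_mem_filt (raises_self' m) g hh) hg
    rwa [mul_sub, mul_one, sub_add_sub_cancel, ← map_mul] at this
  inv_mem' {g} hg := by
    have := neg_mem (image_mul_mem_filt (raises_self' m) g⁻¹ hg)
    rwa [mul_sub, mul_one, ← map_mul, inv_mul_cancel, map_one, neg_sub] at this

theorem congruence_antitone : Antitone (congruence h6) := fun _ _ h _ hg => filt_antitone h hg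

/-- In `gh - 1 = (g - 1)(h - 1) + (g - 1) + (h - 1)` the product lies one step further in the
filtration than `h - 1`, so its coordinate `m` vanishes. -/
theorem coord_mul_sub_one {m : Fin 18} {g h : FreeGroup (Fin 2)}
    (hh : h ∈ congruence h6 m) :
    (basis h6).coord m (image R (g * h) - 1) =
      (basis h6).coord m (image R g - 1) + (basis h6).coord m (image R h - 1) := by
  have h0 := mem_filt.mp (image_sub_one_mul_mem_filt (raises_succ m m.2) g _ hh) m
    (Nat.lt_succ_self _)
  have : image R (g * h) - 1 =
      (image R g - 1) * (image R h - 1) + (image R g - 1) + (image R h - 1) := by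
    rw [map_mul]
    noncomm_ring
  rw [this, map_add, map_add, h0, zero_add]

variable (h6) in
/-- The leading coordinate on a congruence subgroup is additive. -/
def leadingCoord (m : Fin 18) : congruence h6 m →* Multiplicative R where
  toFun g := Multiplicative.ofAdd ((basis h6).coord m (image R g - 1))
  map_one' := by simp
  map_mul' g h := congrArg Multiplicative.ofAdd (coord_mul_sub_one h.2)

theorem coord_zpow {m : Fin 18} {g : FreeGroup (Fin 2)} (hg : g ∈ congruence h6 m) (n : ℤ) :
    (basis h6).coord m (image R (g ^ n) - 1) = n • (basis h6).coord m (image R g - 1) := by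
  have h := congrArg Multiplicative.toAdd (map_zpow (leadingCoord h6 m) ⟨g, hg⟩ n)
  rw [toAdd_zpow] at h
  exact h

/-- Write `g = t ^ n * h` with `h ∈ K`. Coordinate `m` of `g - 1` is `n` times the non-zero one of
`t - 1`, so an image equal to `1` forces `n = 0` and `g = h`. -/
theorem mem_of_mem_zpowers_sup [IsDomain R] [CharZero R] {m : Fin 18}
    {t : FreeGroup (Fin 2)} {K N : Subgroup (FreeGroup (Fin 2))} [K.Normal]
    (ht : t ∈ congruence h6 m) (ht' : (basis h6).coord m (image R t - 1) ≠ 0)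
    (hK : K ≤ congruence h6 (m + 1)) (hN : ∀ h ∈ K, image R h = 1 → h ∈ N) :
    ∀ g ∈ zpowers t ⊔ K, image R g = 1 → g ∈ N := by
  intro g hg hg1
  obtain ⟨_, ⟨n, rfl⟩, h, hh, rfl⟩ := Subgroup.mem_sup_of_normal_right.mp hg
  have hhm := hK hh
  have e := coord_mul_sub_one (g := t ^ n) (congruence_antitone (Nat.le_succ _) hhm)
  rw [hg1, sub_self, map_zero, coord_zpow ht, mem_filt.mp hhm m (Nat.lt_succ_self _), add_zero,
    zsmul_eq_mul] at e
  have hn : n = 0 := by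
    rcases mul_eq_zero.mp e.symm with h | h
    · exact_mod_cast h
    · exact absurd h ht'
  subst hn
  simp only [zpow_zero, one_mul] at hg1 ⊢
  exact hN h hh hg1

/-- The coordinates of the value of an expression minus one. -/
def subOneCoord (p : NCExpr) : CoordVec := (NCExpr.sub p .one).act tableX tableY [1]

theorem image_sub_one_eq_lin (h6 : IsUnit (6 : R)) {p : NCExpr × NCExpr}
    {g : FreeGroup (Fin 2)} (h : Represents R p g) :
    image R g - 1 = CoordVec.lin elem (subOneCoord p.1) := by
  rw [subOneCoord, ← eval_eq_lin h6]
  simp [NCExpr.eval, h.1]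

theorem Represents.mem_congruence {p : NCExpr × NCExpr} {g : FreeGroup (Fin 2)}
    (h : Represents R p g) {m : ℕ} (hm : ∀ i < m, (subOneCoord p.1).getD i 0 = 0) :
    g ∈ congruence h6 m := by
  change image R g - 1 ∈ filt h6 m
  rw [image_sub_one_eq_lin h6 h]
  exact lin_mem_filt hm

theorem Represents.coord_ne_zero [CharZero R] {p : NCExpr × NCExpr} {g : FreeGroup (Fin 2)}
    (h : Represents R p g) {m : Fin 18} (hm : (subOneCoord p.1).getD m 0 ≠ 0) :
    (basis h6).coord m (image R g - 1) ≠ 0 := by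
  rw [image_sub_one_eq_lin h6 h, coord_lin]
  exact_mod_cast hm

/-- The basic commutators of weight at most `4` in two letters. -/
def basicComm : ℕ → NCExpr × NCExpr :=
  let a := (NCExpr.a, NCExpr.aInv)
  let b := (NCExpr.b, NCExpr.bInv)
  let c := NCExpr.comm a b
  fun i => [a, b, c, NCExpr.comm c a, NCExpr.comm c b, NCExpr.comm (NCExpr.comm c a) b,
    NCExpr.comm (NCExpr.comm c a) a, NCExpr.comm (NCExpr.comm c b) b].getD i a

/-- The index of the leading coordinate of a basic commutator. -/
def leadingIndex : ℕ → ℕ := fun i => [1, 2, 4, 8, 10, 11, 12, 15].getD i 0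

theorem leadingIndex_lt : ∀ i < 8, leadingIndex i < 18 := by
  decide

theorem subOneCoord_basicComm : ∀ i < 8,
    (∀ j < leadingIndex i, (subOneCoord (basicComm i).1).getD j 0 = 0) ∧
      (subOneCoord (basicComm i).1).getD (leadingIndex i) 0 ≠ 0 := by
  decide +kernel

/-- Indices from 5 on are the commutators of weight 4. Applying the difference to `1` suffices by
`eval_eq_lin`. -/
theorem act_basicComm_central : ∀ i < 8, 5 ≤ i → ∀ z ∈ [NCExpr.x, NCExpr.y],
    ((NCExpr.sub (.mul (basicComm i).1 z) (.mul z (basicComm i).1)).act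
      tableX tableY [1]).isZero = true := by
  decide +kernel

theorem closure_of : Subgroup.closure {FreeGroup.of (0 : Fin 2), FreeGroup.of 1} = ⊤ := by
  rw [← FreeGroup.closure_range_of]
  congr 1
  ext g
  simp [Fin.exists_fin_two, eq_comm]

theorem augIdeal_mul_self : augIdeal R 3 setP * augIdeal R 3 setP ≤ augIdeal R 3 setP := by
  refine Submodule.mul_le.mpr ?_
  rintro _ ⟨f, hf, rfl⟩ _ ⟨g, hg, rfl⟩
  refine ⟨f * g, ?_, map_mul (proj R 3 setP) f g⟩
  have hf' : augmentation R _ f = 0 := hf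
  exact (map_mul (augmentation R _) f g).trans (by rw [hf', zero_mul])

theorem image_sub_one_mem_pow {k : ℕ} {g : FreeGroup (Fin 2)} (hg : g ∈ lcs _ k) :
    image R g - 1 ∈ augIdeal R 3 setP ^ (k + 1) :=
  sub_one_mem_pow_of_mem_lcs (image R) augIdeal_mul_self image_sub_one_mem_augIdeal k g hg

theorem lcs_le_congruence {k : ℕ} (hk : k < 6) : lcs _ k ≤ congruence h6 (degreeStart (k + 1)) :=
  fun _ hg => augIdeal_pow_le (k + 1) hk (image_sub_one_mem_pow hg)

/-- The kernel of the map from the free group is contained in `γ₅`. -/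
theorem mem_lcs_four_of_image_eq_one [IsDomain R] [CharZero R] (h6 : IsUnit (6 : R))
    (g : FreeGroup (Fin 2)) (hg : image R g = 1) : g ∈ lcs _ 4 := by
  set a := FreeGroup.of (0 : Fin 2)
  set b := FreeGroup.of (1 : Fin 2)
  have ra : Represents R (basicComm 0) a := represents_a
  have rb : Represents R (basicComm 1) b := represents_b
  have rc : Represents R (basicComm 2) ⁅a, b⁆ := ra.comm rb
  have rca : Represents R (basicComm 3) ⁅⁅a, b⁆, a⁆ := rc.comm ra
  have rcb : Represents R (basicComm 4) ⁅⁅a, b⁆, b⁆ := rc.comm rb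
  have rcab : Represents R (basicComm 5) ⁅⁅⁅a, b⁆, a⁆, b⁆ := rca.comm rb
  have rcaa : Represents R (basicComm 6) ⁅⁅⁅a, b⁆, a⁆, a⁆ := rca.comm ra
  have rcbb : Represents R (basicComm 7) ⁅⁅⁅a, b⁆, b⁆, b⁆ := rcb.comm rb
  have mc : ⁅a, b⁆ ∈ lcs _ 1 := Subgroup.commutator_mem_commutator trivial trivial
  have md (g) : ⁅⁅a, b⁆, g⁆ ∈ lcs _ 2 := Subgroup.commutator_mem_commutator mc trivial
  have mf (g h) : ⁅⁅⁅a, b⁆, g⁆, h⁆ ∈ lcs _ 3 := Subgroup.commutator_mem_commutator (md g) trivial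
  have anti (k : ℕ) : lcs (FreeGroup (Fin 2)) (k + 1) ≤ lcs _ k :=
    Subgroup.lowerCentralSeries_antitone _ (Nat.le_succ k)
  -- One link of a chain from `γ₅` up to the whole group: basic commutators are adjoined by
  -- decreasing leading index, and the part of each member with image `1` stays in `γ₅`.
  have step {i : ℕ} (hi : i < 8) {t : FreeGroup (Fin 2)} (rt : Represents R (basicComm i) t)
      {K L : Subgroup (FreeGroup (Fin 2))} (hK : K.Normal) (hL : L ≤ zpowers t ⊔ K)
      (hKc : K ≤ congruence h6 (leadingIndex i + 1))
      (h : ∀ g ∈ K, image R g = 1 → g ∈ lcs _ 4) :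
      (L ≤ congruence h6 (leadingIndex i)) ∧ ∀ g ∈ L, image R g = 1 → g ∈ lcs _ 4 := by
    have hs := subOneCoord_basicComm i hi
    have ht := rt.mem_congruence (h6 := h6) hs.1
    exact ⟨hL.trans (sup_le ((Subgroup.zpowers_le).mpr ht)
        (hKc.trans (congruence_antitone (Nat.le_succ _)))),
      fun g hg => mem_of_mem_zpowers_sup (m := ⟨leadingIndex i, leadingIndex_lt i hi⟩) ht
        (rt.coord_ne_zero hs.2)
        hKc h g (hL hg)⟩
  have up {L : Subgroup (FreeGroup (Fin 2))} {m n : ℕ} (h : L ≤ congruence h6 n) (hmn : m ≤ n) :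
      L ≤ congruence h6 m := h.trans (congruence_antitone hmn)
  have zle {t : FreeGroup (Fin 2)} {k} (ht : t ∈ lcs _ k) : zpowers t ≤ lcs _ k :=
    (Subgroup.zpowers_le).mpr ht
  -- `γ₅` maps into `1 + B⁵`, where the first 16 coordinates of the difference from `1` vanish: just
  -- past the leading index 15.
  have k7 := step (i := 7) (by norm_num) rcbb (K := lcs _ 4) inferInstance le_rfl
    (up (lcs_le_congruence (k := 4) (by norm_num)) (by decide)) fun g hg _ => hg
  have k6 := step (i := 6) (by norm_num) rcaa
    (Subgroup.normal_of_lowerCentralSeries_le le_sup_right (sup_le (zle (mf b b)) (anti 3))) le_rfl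
    (up k7.1 (by decide)) k7.2
  have k5 := step (i := 5) (by norm_num) rcab
    (Subgroup.normal_of_lowerCentralSeries_le (le_sup_right.trans le_sup_right)
      (sup_le (zle (mf a a)) (sup_le (zle (mf b b)) (anti 3))))
    (Subgroup.lowerCentralSeries_three_le closure_of) (up k6.1 (by decide)) k6.2
  have k4 := step (i := 4) (by norm_num) rcb (K := lcs _ 3) inferInstance le_rfl
    (up k5.1 (by decide)) k5.2
  have k3 := step (i := 3) (by norm_num) rca
    (Subgroup.normal_of_lowerCentralSeries_le le_sup_right (sup_le (zle (md b)) (anti 2)))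
    (Subgroup.lowerCentralSeries_two_le closure_of) (up k4.1 (by decide)) k4.2
  have k2 := step (i := 2) (by norm_num) rc (K := lcs _ 2) inferInstance
    (Subgroup.lowerCentralSeries_one_le closure_of) (up k3.1 (by decide)) k3.2
  have k1 := step (i := 1) (by norm_num) rb (K := lcs _ 1) inferInstance le_rfl
    (up k2.1 (by decide)) k2.2
  have k0 := step (i := 0) (by norm_num) ra
    (Subgroup.normal_of_lowerCentralSeries_le (n := 0) le_sup_right le_top)
    (Subgroup.top_le_lowerCentralSeries_one closure_of) (up k1.1 (by decide)) k1.2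
  exact k0.2 g trivial hg

/-- The image of `γ₄` commutes with the image of the free group. -/
theorem image_mul_comm_of_mem_lcs_three (h6 : IsUnit (6 : R)) {g : FreeGroup (Fin 2)}
    (hg : g ∈ lcs _ 3) (h : FreeGroup (Fin 2)) : image R g * image R h = image R h * image R g := by
  set a := FreeGroup.of (0 : Fin 2)
  set b := FreeGroup.of (1 : Fin 2)
  have ra : Represents R (basicComm 0) a := represents_a
  have rb : Represents R (basicComm 1) b := represents_b
  have rc : Represents R (basicComm 2) ⁅a, b⁆ := ra.comm rb
  let Z : Subgroup (FreeGroup (Fin 2)) :=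
    (Subgroup.centralizer (Set.range (unitHom R 3 setP))).comap (unitHom R 3 setP)
  have hZ {g : FreeGroup (Fin 2)} :
      g ∈ Z ↔ ∀ h, image R g * image R h = image R h * image R g := by
    simp only [Z, Subgroup.mem_comap, Subgroup.mem_centralizer_iff, Set.forall_mem_range,
      Units.ext_iff, Units.val_mul, coe_unitHom]
    exact forall_congr' fun _ => eq_comm
  have hcentral {i : ℕ} (hi : i < 8) (hi' : 5 ≤ i) {t : FreeGroup (Fin 2)}
      (rt : Represents R (basicComm i) t) : t ∈ Z := by
    have hz (z : NCExpr) (hz : z ∈ [NCExpr.x, NCExpr.y]) :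
        Commute (image R t) (z.eval (xElem R) (yElem R)) := by
      have e := eval_eq_lin (R := R) h6
        (NCExpr.sub (.mul (basicComm i).1 z) (.mul z (basicComm i).1))
      rw [CoordVec.lin_eq_zero _ (act_basicComm_central i hi hi' z hz)] at e
      simp only [NCExpr.eval, rt.1] at e
      exact sub_eq_zero.mp e
    have hgen (i : Fin 2) : Commute (image R t) (image R (FreeGroup.of i)) := by
      fin_cases i
      · simpa [NCExpr.eval] using (hz .x (by simp)).add_right (Commute.one_right _)
      · simpa [NCExpr.eval] using (hz .y (by simp)).add_right (Commute.one_right _)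
    refine hZ.mpr fun h => ?_
    induction h using FreeGroup.induction_on with
    | C1 => simp
    | of i => exact hgen i
    | inv_of i hi =>
      have hi' : Commute (unitHom R 3 setP t) (unitHom R 3 setP (FreeGroup.of i)) :=
        Units.ext hi
      have := congrArg Units.val (hi'.inv_right).eq
      rwa [← map_inv] at this
    | mul g h hg hh => rw [map_mul, ← mul_assoc, hg, mul_assoc, hh, mul_assoc]
  -- For `g ∈ γ₅` both products of `g - 1` and `h - 1` lie in `B⁶ = 0`. That `γ₅` has trivial image
  -- is not yet known; it is deduced from the present centrality.
  have h4 : lcs _ 4 ≤ Z := by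
    intro g hg
    refine hZ.mpr fun h => ?_
    have h5 := image_sub_one_mem_pow (R := R) hg
    have hh := image_sub_one_mem_augIdeal (R := R) h
    have e1 : (image R g - 1) * (image R h - 1) ∈ augIdeal R 3 setP ^ 6 :=
      (pow_succ (augIdeal R 3 setP) 5).ge (Submodule.mul_mem_mul h5 hh)
    have e2 : (image R h - 1) * (image R g - 1) ∈ augIdeal R 3 setP ^ 6 :=
      (pow_succ' (augIdeal R 3 setP) 5).ge (Submodule.mul_mem_mul hh h5)
    rw [augIdeal_pow_six h6, Submodule.mem_bot] at e1 e2
    have : image R g * image R h - image R h * image R g =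
        (image R g - 1) * (image R h - 1) - (image R h - 1) * (image R g - 1) := by noncomm_ring
    rw [e1, e2, sub_zero] at this
    exact sub_eq_zero.mp this
  have hle := (Subgroup.lowerCentralSeries_three_le closure_of).trans
    (sup_le ((Subgroup.zpowers_le).mpr (hcentral (i := 5) (by norm_num) le_rfl
      ((rc.comm ra).comm rb)))
      (sup_le ((Subgroup.zpowers_le).mpr (hcentral (i := 6) (by norm_num) (by norm_num)
        ((rc.comm ra).comm ra)))
        (sup_le ((Subgroup.zpowers_le).mpr (hcentral (i := 7) (by norm_num) (by norm_num)
          ((rc.comm rb).comm rb))) h4)))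
  exact hZ.mp (hle hg) h

/-- `γ₅ = ⁅γ₄, F₂⁆` is killed because `γ₄` has central image; the other inclusion is the leading
coordinate argument. -/
theorem ker_unitHom [IsDomain R] [CharZero R] (h6 : IsUnit (6 : R)) :
    (unitHom R 3 setP).ker = lcs _ 4 := by
  refine le_antisymm (fun g hg => ?_) ?_
  · exact mem_lcs_four_of_image_eq_one h6 g (congrArg Units.val (MonoidHom.mem_ker.mp hg))
  · refine Subgroup.commutator_le.mpr fun p hp q _ => ?_
    rw [MonoidHom.mem_ker, map_commutatorElement, commutatorElement_eq_one_iff_mul_comm]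
    exact Units.ext (image_mul_comm_of_mem_lcs_three h6 hp q)

theorem exists_mem_lcs_three_unitHom_ne_one [CharZero R] (h6 : IsUnit (6 : R)) :
    ∃ g ∈ lcs _ 3, unitHom R 3 setP g ≠ 1 := by
  set a := FreeGroup.of (0 : Fin 2)
  set b := FreeGroup.of (1 : Fin 2)
  have ra : Represents R (basicComm 0) a := represents_a
  have rb : Represents R (basicComm 1) b := represents_b
  have rf : Represents R (basicComm 5) ⁅⁅⁅a, b⁆, a⁆, b⁆ := ((ra.comm rb).comm ra).comm rb
  refine ⟨⁅⁅⁅a, b⁆, a⁆, b⁆, Subgroup.commutator_mem_commutator (Subgroup.commutator_mem_commutator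
    (Subgroup.commutator_mem_commutator trivial trivial) trivial) trivial, fun h => ?_⟩
  -- 11 is the leading index of this commutator, number 5 in `basicComm`.
  refine rf.coord_ne_zero (h6 := h6) (m := 11) (subOneCoord_basicComm 5 (by norm_num)).2 ?_
  rw [← coe_unitHom, h, Units.val_one, sub_self, map_zero]

end UnipotentQuotient

end

noncomputable section

/-! ### The group-like elements -/

section GroupLike

variable {R : Type*} [CommRing R]

/-- Multiplication by the first letter on coordinates. -/
def mulX (w : Fin 18 → R) : Fin 18 → R :=
  ![0, w 0, 0, w 1, w 2, 0, 0, w 4, w 5, w 6, 0, 0, w 8, w 9, w 10, 0, w 14, w 15]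

/-- Multiplication by the second letter on coordinates. -/
def mulY (w : Fin 18 → R) : Fin 18 → R :=
  ![0, 0, w 0, 0, 0, w 1, w 2, -w 3, -w 3, -w 5, w 4 - w 5, w 3 + w 5 - 2 * w 8, 0, w 8 - w 7,
    -w 7, w 9 - w 10, w 12, -w 13]

theorem mulX_apply (w : Fin 18 → R) :
    mulX w 0 = 0 ∧ mulX w 1 = w 0 ∧ mulX w 2 = 0 ∧ mulX w 3 = w 1 ∧ mulX w 4 = w 2 ∧ mulX w 5 = 0 ∧
      mulX w 6 = 0 ∧ mulX w 7 = w 4 ∧ mulX w 8 = w 5 ∧ mulX w 9 = w 6 ∧ mulX w 10 = 0 ∧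
      mulX w 11 = 0 ∧ mulX w 12 = w 8 ∧ mulX w 13 = w 9 ∧ mulX w 14 = w 10 ∧ mulX w 15 = 0 ∧
      mulX w 16 = w 14 ∧ mulX w 17 = w 15 := by
  refine ⟨?_, ?_, ?_, ?_, ?_, ?_, ?_, ?_, ?_, ?_, ?_, ?_, ?_, ?_, ?_, ?_, ?_, ?_⟩ <;> rfl

theorem mulY_apply (w : Fin 18 → R) :
    mulY w 0 = 0 ∧ mulY w 1 = 0 ∧ mulY w 2 = w 0 ∧ mulY w 3 = 0 ∧ mulY w 4 = 0 ∧ mulY w 5 = w 1 ∧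
      mulY w 6 = w 2 ∧ mulY w 7 = -w 3 ∧ mulY w 8 = -w 3 ∧ mulY w 9 = -w 5 ∧
      mulY w 10 = w 4 - w 5 ∧ mulY w 11 = w 3 + w 5 - 2 * w 8 ∧ mulY w 12 = 0 ∧
      mulY w 13 = w 8 - w 7 ∧ mulY w 14 = -w 7 ∧ mulY w 15 = w 9 - w 10 ∧ mulY w 16 = w 12 ∧
      mulY w 17 = -w 13 := by
  refine ⟨?_, ?_, ?_, ?_, ?_, ?_, ?_, ?_, ?_, ?_, ?_, ?_, ?_, ?_, ?_, ?_, ?_, ?_⟩ <;> rfl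

/-- Multiplication by the linear combination of `basisPolys` with coefficients `v`. -/
def mulCoord (v w : Fin 18 → R) : Fin 18 → R :=
  v 0 • w + v 1 • mulX w + v 2 • mulY w + v 3 • mulX (mulX w) + v 4 • mulX (mulY w) +
    v 5 • mulY (mulX w) + v 6 • mulY (mulY w) + v 7 • mulX (mulX (mulY w)) +
    v 8 • mulX (mulY (mulX w)) + v 9 • mulX (mulY (mulY w)) + v 10 • mulY (mulX (mulY w)) +
    v 11 • (mulY (mulX (mulX w)) + mulX (mulY (mulX w)) + mulX (mulX (mulY w))) +
    v 12 • mulX (mulX (mulY (mulX w))) + v 13 • mulX (mulX (mulY (mulY w))) +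
    v 14 • mulX (mulY (mulX (mulY w))) + v 15 • mulY (mulX (mulY (mulY w))) +
    v 16 • mulX (mulX (mulY (mulX (mulY w)))) + v 17 • mulX (mulY (mulX (mulY (mulY w))))

/-- The coordinates of group-like elements: the equations in degree at most `3`. -/
structure IsGroupLike (w : Fin 18 → R) : Prop where
  zero : w 0 = 1
  three : 2 * w 3 = w 1 ^ 2 - w 1
  five : w 5 = w 1 * w 2 - w 4
  six : 2 * w 6 = w 2 ^ 2 - w 2
  seven : 2 * w 7 = 2 * w 1 * w 4 - 2 * w 4 + w 1 * w 2 - w 1 ^ 2 * w 2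
  nine : 2 * w 9 = 2 * w 2 * w 4 - 2 * w 4 + w 1 * w 2 - w 1 * w 2 ^ 2

theorem IsGroupLike.one : IsGroupLike (Pi.single (0 : Fin 18) (1 : R)) := by
  constructor <;> simp

/-- This and the next three lemmas are the induction steps for words: left multiplication by `1 +
x`, `1 + y` and their inverses. -/
theorem IsGroupLike.add_mulX {w : Fin 18 → R} (h : IsGroupLike w) : IsGroupLike (w + mulX w) := by
  obtain ⟨h0, h3, h5, h6, h7, h9⟩ := h
  constructor <;> simp only [mulX, Pi.add_apply, Matrix.cons_val, h0, h5]
  · ring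
  · linear_combination h3
  · ring
  · linear_combination h6
  · linear_combination h7
  · linear_combination h9 + h6

theorem IsGroupLike.add_mulY {w : Fin 18 → R} (h : IsGroupLike w) : IsGroupLike (w + mulY w) := by
  obtain ⟨h0, h3, h5, h6, h7, h9⟩ := h
  constructor <;> simp only [mulY, Pi.add_apply, Matrix.cons_val, h0, h5]
  · ring
  · linear_combination h3
  · ring
  · linear_combination h6
  · linear_combination h7 - h3
  · linear_combination h9

theorem IsGroupLike.sub_mulX {w : Fin 18 → R} (h : IsGroupLike w) :
    IsGroupLike (w - mulX w + mulX (mulX w)) := by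
  obtain ⟨h0, h3, h5, h6, h7, h9⟩ := h
  constructor <;> simp only [mulX, Pi.add_apply, Pi.sub_apply, Matrix.cons_val, h0, h5]
  · ring
  · linear_combination h3
  · ring
  · linear_combination h6
  · linear_combination h7
  · linear_combination h9 - h6

theorem IsGroupLike.sub_mulY {w : Fin 18 → R} (h : IsGroupLike w) :
    IsGroupLike (w - mulY w + mulY (mulY w)) := by
  obtain ⟨h0, h3, h5, h6, h7, h9⟩ := h
  constructor <;> simp only [mulY, Pi.add_apply, Pi.sub_apply, Matrix.cons_val, h0, h5]
  · ring
  · linear_combination h3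
  · ring
  · linear_combination h6
  · linear_combination h7 + h3
  · linear_combination h9

theorem mulCoord_apply {v w : Fin 18 → R} (hv : v 0 = 0) (hw : w 0 = 0) :
    mulCoord v w 0 = 0 ∧
    mulCoord v w 1 = 0 ∧
    mulCoord v w 2 = 0 ∧
    mulCoord v w 3 = v 1 * w 1 ∧
    mulCoord v w 4 = v 1 * w 2 ∧
    mulCoord v w 5 = v 2 * w 1 ∧
    mulCoord v w 6 = v 2 * w 2 ∧
    mulCoord v w 7 = v 1 * w 4 - v 2 * w 3 + v 3 * w 2 - v 5 * w 1 ∧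
    mulCoord v w 8 = v 1 * w 5 - v 2 * w 3 + v 4 * w 1 - v 5 * w 1 ∧
    mulCoord v w 9 = v 1 * w 6 - v 2 * w 5 + v 4 * w 2 - v 6 * w 1 ∧
    mulCoord v w 10 = v 2 * w 4 - v 2 * w 5 + v 5 * w 2 - v 6 * w 1 ∧
    mulCoord v w 11 = v 2 * w 3 + v 2 * w 5 - 2 * v 2 * w 8 + v 5 * w 1 - 2 * v 5 * w 5 + v 6 * w
      1 + 2 * v 6 * w 3 - 2 * v 10 * w 1 ∧
    mulCoord v w 12 = v 1 * w 8 + v 3 * w 5 - v 4 * w 3 + v 7 * w 1 - v 8 * w 1 ∧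
    mulCoord v w 13 = v 1 * w 9 - v 2 * w 7 + v 2 * w 8 + v 3 * w 6 - v 4 * w 5 - v 5 * w 4 + v 5
      * w 5 + v 7 * w 2 - v 9 * w 1 + v 10 * w 1 ∧
    mulCoord v w 14 = v 1 * w 10 - v 2 * w 7 + v 4 * w 4 - v 4 * w 5 - v 5 * w 4 + v 6 * w 3 + v
      8 * w 2 - v 9 * w 1 ∧
    mulCoord v w 15 = v 2 * w 9 - v 2 * w 10 + v 5 * w 6 - v 6 * w 4 + v 10 * w 2 ∧
    mulCoord v w 16 = v 1 * w 14 + v 2 * w 12 + v 3 * w 10 - v 4 * w 7 + v 5 * w 8 + v 7 * w 4 -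
      v 7 * w 5 - v 8 * w 4 + v 9 * w 3 - v 10 * w 3 + v 12 * w 2 - v 13 * w 1 ∧
    mulCoord v w 17 = v 1 * w 15 - v 2 * w 13 + v 4 * w 9 - v 4 * w 10 - v 5 * w 9 + v 6 * w 7 -
      v 6 * w 8 + v 8 * w 6 - v 9 * w 4 + v 10 * w 5 + v 14 * w 2 + v 15 * w 1 := by
  refine ⟨?_, ?_, ?_, ?_, ?_, ?_, ?_, ?_, ?_, ?_, ?_, ?_, ?_, ?_, ?_, ?_, ?_, ?_⟩ <;>
    simp only [mulCoord, Pi.add_apply, Pi.smul_apply, smul_eq_mul, mulX_apply, mulY_apply, hv,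
      hw] <;>
    ring

/-- Coordinates from 11 on have degree at least 4 and cannot affect a cube, as products of degree 6
vanish; so they are left arbitrary. The others are those of `2(g - 1)`, where `p, q, r, s, t` are
the free coordinates 1, 2, 4, 8, 10 of `g`. The result is a polynomial identity. -/
theorem mulCoord_cube {v : Fin 18 → R} {p q r s t : R} (h0 : v 0 = 0) (h1 : v 1 = 2 * p)
    (h2 : v 2 = 2 * q) (h3 : v 3 = p ^ 2 - p) (h4 : v 4 = 2 * r) (h5 : v 5 = 2 * (p * q - r))
    (h6 : v 6 = q ^ 2 - q) (h7 : v 7 = 2 * p * r - 2 * r + p * q - p ^ 2 * q)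
    (h8 : v 8 = 2 * s) (h9 : v 9 = 2 * q * r - 2 * r + p * q - p * q ^ 2) (h10 : v 10 = 2 * t) :
    mulCoord v (mulCoord v v) = 0 := by
  have e := mulCoord_apply h0 h0
  have e' := mulCoord_apply h0 e.1
  funext i
  fin_cases i <;>
    simp only [Fin.zero_eta, Fin.mk_one, Fin.reduceFinMk, Pi.zero_apply, e', e, h1, h2, h3, h4, h5,
      h6, h7, h8, h9, h10] <;>
    ring

end GroupLike

/-! ### Transfer of the coordinate formulas to the ring. -/

section Cube

variable {R S : Type*} [CommRing R] [Ring S] [Algebra R S] {x y : S}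

/-- The linear combination of the values of `basisPolys` with given coefficients. -/
def ofCoord (x y : S) : (Fin 18 → R) →ₗ[R] S := Fintype.linearCombination R fun i => basisElem x y i

theorem ofCoord_apply (w : Fin 18 → R) : ofCoord x y w =
    w 0 • basisElem x y 0 + w 1 • basisElem x y 1 + w 2 • basisElem x y 2 +
    w 3 • basisElem x y 3 + w 4 • basisElem x y 4 + w 5 • basisElem x y 5 +
    w 6 • basisElem x y 6 + w 7 • basisElem x y 7 + w 8 • basisElem x y 8 +
    w 9 • basisElem x y 9 + w 10 • basisElem x y 10 + w 11 • basisElem x y 11 +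
    w 12 • basisElem x y 12 + w 13 • basisElem x y 13 + w 14 • basisElem x y 14 +
    w 15 • basisElem x y 15 + w 16 • basisElem x y 16 + w 17 • basisElem x y 17 := by
  simp only [ofCoord, Fintype.linearCombination_apply, Fin.sum_univ_castSucc, Fin.sum_univ_zero,
    zero_add]
  rfl

theorem x_mul_ofCoord
    (h : ∀ i, x * basisElem x y i = CoordVec.lin (basisElem x y) (tableX.getD i []))
    (w : Fin 18 → R) : x * ofCoord x y w = ofCoord x y (mulX w) := by
  have row (i : ℕ) (l : CoordVec) (hl : tableX.getD i [] = l) :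
      x * basisElem x y i = CoordVec.lin (basisElem x y) l := hl ▸ h i
  have h0 := row 0 [0, 1] rfl
  have h1 := row 1 [0, 0, 0, 1] rfl
  have h2 := row 2 [0, 0, 0, 0, 1] rfl
  have h3 := row 3 [] rfl
  have h4 := row 4 [0, 0, 0, 0, 0, 0, 0, 1] rfl
  have h5 := row 5 [0, 0, 0, 0, 0, 0, 0, 0, 1] rfl
  have h6 := row 6 [0, 0, 0, 0, 0, 0, 0, 0, 0, 1] rfl
  have h7 := row 7 [] rfl
  have h8 := row 8 [0, 0, 0, 0, 0, 0, 0, 0, 0, 0, 0, 0, 1] rfl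
  have h9 := row 9 [0, 0, 0, 0, 0, 0, 0, 0, 0, 0, 0, 0, 0, 1] rfl
  have h10 := row 10 [0, 0, 0, 0, 0, 0, 0, 0, 0, 0, 0, 0, 0, 0, 1] rfl
  have h11 := row 11 [] rfl
  have h12 := row 12 [] rfl
  have h13 := row 13 [] rfl
  have h14 := row 14 [0, 0, 0, 0, 0, 0, 0, 0, 0, 0, 0, 0, 0, 0, 0, 0, 1] rfl
  have h15 := row 15 [0, 0, 0, 0, 0, 0, 0, 0, 0, 0, 0, 0, 0, 0, 0, 0, 0, 1] rfl
  have h16 := row 16 [] rfl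
  have h17 := row 17 [] rfl
  simp only [ofCoord_apply, mulX_apply, mul_add, mul_smul_comm, CoordVec.lin, zero_smul, smul_zero,
    one_smul, zero_add, add_zero, h0, h1, h2, h3, h4, h5, h6, h7, h8,
    h9, h10, h11, h12, h13, h14, h15, h16, h17]

theorem y_mul_ofCoord
    (h : ∀ i, y * basisElem x y i = CoordVec.lin (basisElem x y) (tableY.getD i []))
    (w : Fin 18 → R) : y * ofCoord x y w = ofCoord x y (mulY w) := by
  have row (i : ℕ) (l : CoordVec) (hl : tableY.getD i [] = l) :
      y * basisElem x y i = CoordVec.lin (basisElem x y) l := hl ▸ h i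
  have h0 := row 0 [0, 0, 1] rfl
  have h1 := row 1 [0, 0, 0, 0, 0, 1] rfl
  have h2 := row 2 [0, 0, 0, 0, 0, 0, 1] rfl
  have h3 := row 3 [0, 0, 0, 0, 0, 0, 0, -1, -1, 0, 0, 1] rfl
  have h4 := row 4 [0, 0, 0, 0, 0, 0, 0, 0, 0, 0, 1] rfl
  have h5 := row 5 [0, 0, 0, 0, 0, 0, 0, 0, 0, -1, -1, 1] rfl
  have h6 := row 6 [] rfl
  have h7 := row 7 [0, 0, 0, 0, 0, 0, 0, 0, 0, 0, 0, 0, 0, -1, -1] rfl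
  have h8 := row 8 [0, 0, 0, 0, 0, 0, 0, 0, 0, 0, 0, -2, 0, 1] rfl
  have h9 := row 9 [0, 0, 0, 0, 0, 0, 0, 0, 0, 0, 0, 0, 0, 0, 0, 1] rfl
  have h10 := row 10 [0, 0, 0, 0, 0, 0, 0, 0, 0, 0, 0, 0, 0, 0, 0, -1] rfl
  have h11 := row 11 [] rfl
  have h12 := row 12 [0, 0, 0, 0, 0, 0, 0, 0, 0, 0, 0, 0, 0, 0, 0, 0, 1] rfl
  have h13 := row 13 [0, 0, 0, 0, 0, 0, 0, 0, 0, 0, 0, 0, 0, 0, 0, 0, 0, -1] rfl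
  have h14 := row 14 [] rfl
  have h15 := row 15 [] rfl
  have h16 := row 16 [] rfl
  have h17 := row 17 [] rfl
  simp only [ofCoord_apply, mulY_apply, mul_add, mul_smul_comm, CoordVec.lin, zero_smul, smul_zero,
    one_smul, neg_smul, zero_add, add_zero, h0, h1, h2, h3, h4, h5, h6, h7, h8,
    h9, h10, h11, h12, h13, h14, h15, h16, h17]
  module

theorem ofCoord_single_zero : ofCoord x y (Pi.single (0 : Fin 18) (1 : R)) = 1 := by
  simp [ofCoord_apply, basisElem, basisPolys, NCPoly.eval, NCWord.eval]

theorem ofCoord_mul_ofCoord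
    (hx : ∀ i, x * basisElem x y i = CoordVec.lin (basisElem x y) (tableX.getD i []))
    (hy : ∀ i, y * basisElem x y i = CoordVec.lin (basisElem x y) (tableY.getD i []))
    (v w : Fin 18 → R) : ofCoord x y v * ofCoord x y w = ofCoord x y (mulCoord v w) := by
  rw [ofCoord_apply v]
  simp only [basisElem, basisPolys, List.getD_cons_zero, List.getD_cons_succ, NCPoly.eval,
    NCWord.eval, cond_true, cond_false, mulCoord, map_add, map_smul, add_mul, smul_mul_assoc,
    one_smul, add_zero, mul_one, one_mul, mul_assoc, x_mul_ofCoord hx, y_mul_ofCoord hy]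
  module

theorem sub_one_cube_eq_zero (h2 : IsUnit (2 : R))
    (hx : ∀ i, x * basisElem x y i = CoordVec.lin (basisElem x y) (tableX.getD i []))
    (hy : ∀ i, y * basisElem x y i = CoordVec.lin (basisElem x y) (tableY.getD i []))
    {w : Fin 18 → R} (hw : IsGroupLike w) : (ofCoord x y w - 1) ^ 3 = 0 := by
  -- Doubling clears the halves in the equations of `IsGroupLike`; the resulting factor 8 of the
  -- cube is invertible.
  set v : Fin 18 → R := (2 : R) • (w - Pi.single 0 1) with hv
  have hv0 : v 0 = 0 := by simp [hv, hw.zero]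
  have hvs (i : Fin 18) (hi : i ≠ 0) : v i = 2 * w i := by simp [hv, hi]
  have e : (2 : R) • (ofCoord x y w - 1) = ofCoord x y v := by
    rw [hv, map_smul, map_sub, ofCoord_single_zero]
  have hz : mulCoord v (mulCoord v v) = 0 := by
    refine mulCoord_cube (p := w 1) (q := w 2) (r := w 4) (s := w 8) (t := w 10) hv0
      (hvs _ (by decide)) (hvs _ (by decide)) ?_ (hvs _ (by decide)) ?_ ?_ ?_ (hvs _ (by decide))
      ?_ (hvs _ (by decide)) <;> rw [hvs _ (by decide)]
    · exact hw.three
    · rw [hw.five]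
    · exact hw.six
    · exact hw.seven
    · exact hw.nine
  have h8 : (8 : R) • (ofCoord x y w - 1) ^ 3 = 0 := by
    have : ((2 : R) • (ofCoord x y w - 1)) ^ 3 = 0 := by
      rw [e, pow_succ', pow_two, ofCoord_mul_ofCoord hx hy, ofCoord_mul_ofCoord hx hy, hz, map_zero]
    rw [smul_pow] at this
    norm_num at this
    exact this
  have h8' : IsUnit (8 : R) := by
    have := h2.pow 3
    norm_num at this
    exact this
  exact (h8'.smul_eq_zero).mp h8

end Cube

namespace UnipotentQuotient

variable {R : Type*} [CommRing R]

theorem _root_.one_sub_add_mul_self_mul {S : Type*} [Ring S] (x z : S) :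
    (1 - x + x * x) * z = z - x * z + x * (x * z) := by
  rw [add_mul, sub_mul, one_mul, mul_assoc]

theorem exists_isGroupLike (h6 : IsUnit (6 : R)) (g : FreeGroup (Fin 2)) :
    ∃ w : Fin 18 → R, IsGroupLike w ∧ ofCoord (xElem R) (yElem R) w = image R g := by
  have hX (w : Fin 18 → R) := x_mul_ofCoord (fun i => (mul_elem h6 i).1) w
  have hY (w : Fin 18 → R) := y_mul_ofCoord (fun i => (mul_elem h6 i).2) w
  -- An arbitrary group-like `w` is needed for the induction, since a product `g * h` acts by `h`
  -- and then by `g`.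
  suffices ∀ w : Fin 18 → R, IsGroupLike w → ∃ w', IsGroupLike w' ∧
      ofCoord (xElem R) (yElem R) w' = image R g * ofCoord (xElem R) (yElem R) w by
    obtain ⟨w, hw, e⟩ := this _ .one
    refine ⟨w, hw, e.trans ?_⟩
    rw [ofCoord_single_zero, mul_one]
  induction g using FreeGroup.induction_on with
  | C1 => exact fun w hw => ⟨w, hw, by rw [map_one, one_mul]⟩
  | of i =>
    intro w hw
    fin_cases i
    · refine ⟨_, hw.add_mulX, ?_⟩
      change _ = image R (FreeGroup.of 0) * _
      rw [map_add, ← hX, sub_mul, one_mul, add_sub_cancel]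
    · refine ⟨_, hw.add_mulY, ?_⟩
      change _ = image R (FreeGroup.of 1) * _
      rw [map_add, ← hY, sub_mul, one_mul, add_sub_cancel]
  | inv_of i _ =>
    intro w hw
    fin_cases i
    · refine ⟨_, hw.sub_mulX, ?_⟩
      change _ = image R (FreeGroup.of 0)⁻¹ * _
      rw [map_add, map_sub, ← hX, ← hX, ← hX, map_of_inv_of_cube_eq_zero _ (xElem_cube R)]
      exact (one_sub_add_mul_self_mul (xElem R) _).symm
    · refine ⟨_, hw.sub_mulY, ?_⟩
      change _ = image R (FreeGroup.of 1)⁻¹ * _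
      rw [map_add, map_sub, ← hY, ← hY, ← hY, map_of_inv_of_cube_eq_zero _ (yElem_cube R)]
      exact (one_sub_add_mul_self_mul (yElem R) _).symm
  | mul g h hg hh =>
    intro w hw
    obtain ⟨w₁, hw₁, e₁⟩ := hh w hw
    obtain ⟨w₂, hw₂, e₂⟩ := hg w₁ hw₁
    exact ⟨w₂, hw₂, by rw [e₂, e₁, map_mul, mul_assoc]⟩

theorem image_sub_one_cube (h6 : IsUnit (6 : R)) (g : FreeGroup (Fin 2)) :
    (image R g - 1) ^ 3 = 0 := by
  obtain ⟨w, hw, e⟩ := exists_isGroupLike h6 g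
  have h2 : IsUnit (2 : R) := isUnit_of_dvd_unit ⟨3, by norm_num⟩ h6
  rw [← e]
  exact sub_one_cube_eq_zero h2 (fun i => (mul_elem h6 i).1) (fun i => (mul_elem h6 i).2) hw

end UnipotentQuotient

end

/-! ### The ring `ℤ[1/6]`, the nilpotency class, and the final assembly. -/

noncomputable section

theorem isUnit_six_zInvSix : IsUnit (6 : ZInvSix) := by
  simpa using IsLocalization.Away.algebraMap_isUnit (S := ZInvSix) (6 : ℤ)

theorem powers_six_le : Submonoid.powers (6 : ℤ) ≤ nonZeroDivisors ℤ :=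
  powers_le_nonZeroDivisors_of_noZeroDivisors (by norm_num)

instance : IsDomain ZInvSix := IsLocalization.isDomain_localization powers_six_le

instance : CharZero ZInvSix :=
  charZero_of_injective_algebraMap (IsLocalization.injective ZInvSix powers_six_le)

namespace UnipotentQuotient

/-- The lower central series of the range is the image of the lower central series. -/
theorem _root_.MonoidHom.lcs_range {G H : Type*} [Group G] [Group H] (f : G →* H) (n : ℕ) :
    Subgroup.lcs f.range n = (Subgroup.lcs G n).map f.rangeRestrict := by
  rw [Subgroup.map_lowerCentralSeries, ← MonoidHom.range_eq_map,
    MonoidHom.range_eq_top_of_surjective _ f.rangeRestrict_surjective]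

theorem _root_.MonoidHom.lcs_range_eq_bot_iff {G H : Type*} [Group G] [Group H] (f : G →* H)
    (n : ℕ) : Subgroup.lcs f.range n = ⊥ ↔ Subgroup.lcs G n ≤ f.ker := by
  rw [f.lcs_range, Subgroup.map_eq_bot_iff, MonoidHom.ker_rangeRestrict]

variable {R : Type*} [CommRing R]

theorem lcs_four_imageGroup [IsDomain R] [CharZero R] (h6 : IsUnit (6 : R)) :
    Subgroup.lcs (imageGroup R 3 setP) 4 = ⊥ :=
  ((unitHom R 3 setP).lcs_range_eq_bot_iff 4).mpr (ker_unitHom h6).ge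

theorem lcs_three_imageGroup_ne_bot [CharZero R] (h6 : IsUnit (6 : R)) :
    Subgroup.lcs (imageGroup R 3 setP) 3 ≠ ⊥ := by
  intro h
  obtain ⟨g, hg, hg'⟩ := exists_mem_lcs_three_unitHom_ne_one (R := R) h6
  exact hg' (((unitHom R 3 setP).lcs_range_eq_bot_iff 3).mp h hg)

variable [IsDomain R] [CharZero R]

theorem isNilpotent_imageGroup (h6 : IsUnit (6 : R)) : Group.IsNilpotent (imageGroup R 3 setP) :=
  Subgroup.nilpotent_iff_lowerCentralSeries.mpr ⟨4, lcs_four_imageGroup h6⟩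

theorem nilpotencyClass_imageGroup (h6 : IsUnit (6 : R)) :
    Group.nilpotencyClass (imageGroup R 3 setP) = 4 := by
  have := isNilpotent_imageGroup h6
  refine le_antisymm
    (Subgroup.lowerCentralSeries_eq_bot_iff_nilpotencyClass_le.mp (lcs_four_imageGroup h6)) ?_
  by_contra h
  exact lcs_three_imageGroup_ne_bot h6
    (Subgroup.lowerCentralSeries_eq_bot_iff_nilpotencyClass_le.mpr (by omega))

/-- The free nilpotent group of class `4` is isomorphic to the image of the free group. -/
def freeNilpotentEquiv (h6 : IsUnit (6 : R)) :
    FreeNilpotentGroup (Fin 2) 4 ≃* imageGroup R 3 setP :=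
  (QuotientGroup.quotientMulEquivOfEq (ker_unitHom h6).symm).trans
    (QuotientGroup.quotientKerEquivRange (unitHom R 3 setP))

end UnipotentQuotient

end

open UnipotentQuotient

theorem theorem3 :
    -- (i) the quotient ring is a free module of rank 18
    (Module.Free ZInvSix (UnipotentQuotient ZInvSix 3 setP) ∧
      Module.finrank ZInvSix (UnipotentQuotient ZInvSix 3 setP) = 18) ∧
    -- (ii) its augmentation ideal is nilpotent of degree exactly 6
    (UnipotentQuotient.augIdeal ZInvSix 3 setP ^ 6 = ⊥ ∧
      UnipotentQuotient.augIdeal ZInvSix 3 setP ^ 5 ≠ ⊥) ∧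
    -- (iii) the image of the free group is free nilpotent of class 4 on the images of y₁, y₂
    (Group.IsNilpotent (UnipotentQuotient.imageGroup ZInvSix 3 setP) ∧
      Group.nilpotencyClass (UnipotentQuotient.imageGroup ZInvSix 3 setP) = 4 ∧
      ∃ e : FreeNilpotentGroup (Fin 2) 4 ≃* UnipotentQuotient.imageGroup ZInvSix 3 setP,
        ∀ i : Fin 2,
          ((e (QuotientGroup.mk (FreeGroup.of i)) :
              UnipotentQuotient.imageGroup ZInvSix 3 setP) :
            (UnipotentQuotient ZInvSix 3 setP)ˣ) =
            UnipotentQuotient.unitHom ZInvSix 3 setP (FreeGroup.of i)) ∧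
    -- (iv) every element of the image of the free group satisfies (x - 1) ^ 3 = 0
    (∀ x ∈ UnipotentQuotient.imageGroup ZInvSix 3 setP,
      ((x : UnipotentQuotient ZInvSix 3 setP) - 1) ^ 3 = 0) := by
  have h6 := isUnit_six_zInvSix
  refine ⟨⟨Module.Free.of_basis (basis h6), ?_⟩, ⟨augIdeal_pow_six h6,
    augIdeal_pow_five_ne_bot h6⟩, ⟨isNilpotent_imageGroup h6, nilpotencyClass_imageGroup h6,
      freeNilpotentEquiv h6, fun _ => rfl⟩, ?_⟩
  · rw [Module.finrank_eq_card_basis (basis h6), Fintype.card_fin]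
  · rintro _ ⟨g, rfl⟩
    exact image_sub_one_cube h6 g
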